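/- Let $\xi\in\mathbb{N}$ be a failure level, $\mathscr{X}=\{0,1,\dots,\xi\}$ the set of deterioration levels, and $\mathscr{S}=[0,\bar s]$ with $0<\bar s<\infty$ the set of production rates. Let the deterioration function $f:\mathscr{S}\to\mathbb{R}_+$ be continuous and increasing with $f(0)=0$; let the revenue function $r:\mathscr{S}\to\mathbb{R}$ be continuous and monotone (increasing or decreasing) with $r(0)\le 0$; and let the maintenance cost $c_m:\mathscr{X}\to\mathbb{R}_+$ be increasing and convex, that is, $c_m(y+1)-c_m(y)\le c_m(y+2)-c_m(y+1)$ whenever $y+2\le\xi$ (increasing and decreasing are meant in the weak sense). Let $\lambda\ge 0$ be the base rate. Starting from deterioration level $x\in\mathscr{X}$ with a time $t\ge 0$ to go until the next scheduled maintenance, the deterioration level increases by unit jumps. A policy $u$ chooses, in a measurable and non-anticipating way (as a function of the elapsed time and of the times of all past jumps), a production rate $s\in\mathscr{S}$ at each moment; while the rate $s$ is in force, the stochastic intensity of the jumps is $\lambda f(s)$ and revenue accrues at rate $r(s)$. A policy is admissible if it turns the system off ($s=0$) once the deterioration level $\xi$ has been reached. Let $\mathscr{U}$ be the set of admissible policies.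 Let $s^u_\tau$ be the production rate at elapsed time $\tau$ and $L^u_\tau$ the deterioration level at elapsed time $\tau$, so $L^u_0=x$, and put $$J^u_\lambda(x,t)=\mathbb{E}_u\Big[\int_0^t r(s^u_\tau)\,d\tau-c_m\big(L^u_t\big)\Big],\qquad J^*_\lambda(x,t)=\sup_{u\in\mathscr{U}}J^u_\lambda(x,t).$$ Then for every $x\in\mathscr{X}$ and every $\lambda\ge 0$, the function $t\mapsto J^*_\lambda(x,t)$ is concave on $[0,\infty)$. -/

import Mathlib

open MeasureTheory ProbabilityTheory
open scoped ENNReal NNReal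

/-- An admissible non-anticipating production policy for a system with maximum production rate
`sbar` and failure level `ξ`, started in deterioration level `x`.
Time `τ` is the time elapsed since the start.  `rate n h τ` is the production rate used at time `τ`
when exactly `n` deterioration increments have occurred so far, at the times `h 0 ≤ ⋯ ≤ h (n - 1)`;
so the rate may depend in any (measurable) way on the observed past, and on nothing else.
Once the failure level has been reached, the system is turned off. -/
structure ProductionPolicy (sbar : ℝ) (ξ x : ℕ) where
  rate : (n : ℕ) → (Fin n → ℝ) → ℝ → ℝ
  measurable_rate : ∀ n, Measurable fun p : (Fin n → ℝ) × ℝ => rate n p.1 p.2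
  rate_mem : ∀ n h τ, rate n h τ ∈ Set.Icc 0 sbar
  rate_eq_zero : ∀ n h τ, ξ ≤ x + n → rate n h τ = 0

namespace ProductionPolicy

/-- The law of a sequence of independent exponential random variables with mean `1`. -/
noncomputable def noise : Measure (ℕ → ℝ) :=
  haveI : IsProbabilityMeasure (expMeasure 1) := isProbabilityMeasure_expMeasure one_pos
  Measure.infinitePi fun _ : ℕ => expMeasure 1

/-- The last entry of a finite sequence of increment times, and the start `0` if there is none. -/
def lastTime : {n : ℕ} → (Fin n → ℝ≥0∞) → ℝ≥0∞
  | 0, _ => 0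
  | n + 1, h => h (Fin.last n)

variable {sbar : ℝ} {ξ x : ℕ}

/-- The time of the next increment after the increments at times `h`, of which there are `n`: the
first time at which the intensity `lam * f (rate)`, integrated since the last increment, has
reached the level `e` (and `∞` if it never does).  For exponential `e` with mean `1`, the next
increment therefore has the stochastic intensity `lam * f (rate)`, given the past. -/
noncomputable def nextTime (f : ℝ → ℝ) (lam : ℝ) (u : ProductionPolicy sbar ξ x) {n : ℕ}
    (h : Fin n → ℝ≥0∞) (e : ℝ) : ℝ≥0∞ :=
  ⨅ (τ : ℝ≥0) (_ : lastTime h ≤ τ ∧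
    e ≤ ∫ v in (lastTime h).toReal..τ, lam * f (u.rate n (fun i => (h i).toReal) v)), (τ : ℝ≥0∞)

/-- The times of the first `n` deterioration increments under the policy `u`, in increasing order;
`E` is the driving sequence of independent unit exponential random variables.  In other words, the
number of increments up to time `τ` is the value of a Poisson process of rate `1`, whose
interarrival times are `E`, at the integrated intensity `∫₀^τ lam * f (rate)`. -/
noncomputable def incrementTimes (f : ℝ → ℝ) (lam : ℝ) (u : ProductionPolicy sbar ξ x)
    (E : ℕ → ℝ) : (n : ℕ) → Fin n → ℝ≥0∞
  | 0 => Fin.elim0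
  | n + 1 => Fin.snoc (α := fun _ => ℝ≥0∞) (incrementTimes f lam u E n)
      (nextTime f lam u (incrementTimes f lam u E n) (E n))

/-- The number of deterioration increments up to time `τ` (the increments are numbered from `0`). -/
noncomputable def increments (f : ℝ → ℝ) (lam : ℝ) (u : ProductionPolicy sbar ξ x)
    (E : ℕ → ℝ) (τ : ℝ) : ℕ :=
  {n : ℕ | incrementTimes f lam u E (n + 1) (Fin.last n) ≤ ENNReal.ofReal τ}.ncard

/-- The production rate in force at time `τ`. -/
noncomputable def productionRate (f : ℝ → ℝ) (lam : ℝ) (u : ProductionPolicy sbar ξ x)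
    (E : ℕ → ℝ) (τ : ℝ) : ℝ :=
  u.rate (increments f lam u E τ)
    (fun i => (incrementTimes f lam u E (increments f lam u E τ) i).toReal) τ

/-- The realized profit when maintenance takes place at time `t`: the accumulated revenue minus the
maintenance cost in the deterioration level reached at time `t`. -/
noncomputable def profit (f r : ℝ → ℝ) (c : ℕ → ℝ) (lam : ℝ) (u : ProductionPolicy sbar ξ x)
    (t : ℝ) (E : ℕ → ℝ) : ℝ :=
  (∫ τ in (0 : ℝ)..t, r (productionRate f lam u E τ)) - c (x + increments f lam u E t)

/-- The expected profit of the policy `u`. -/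
noncomputable def expectedProfit (f r : ℝ → ℝ) (c : ℕ → ℝ) (lam : ℝ)
    (u : ProductionPolicy sbar ξ x) (t : ℝ) : ℝ :=
  ∫ E, profit f r c lam u t E ∂noise

end ProductionPolicy

/-- The optimal expected profit when the deterioration level is `x` and the next maintenance is
scheduled after a time `t`: the supremum over all admissible policies. -/
noncomputable def optimalProfit (sbar : ℝ) (ξ : ℕ) (f r : ℝ → ℝ) (c : ℕ → ℝ) (lam : ℝ) (x : ℕ)
    (t : ℝ) : ℝ :=
  ⨆ u : ProductionPolicy sbar ξ x, u.expectedProfit f r c lam t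

/-! Dynamic programming reduces the claim to a chain of scalar differential equations. With `H d =
sup_s (r s - λ f(s) d)`, the optimal profit `V y` at level `y`, as a function of the time to go,
satisfies `(V y)' = H (V y - V (y+1))` for `y < ξ`, `(V ξ)' = r 0` and `V y 0 = -c y`. Since `f ≥
0`, `H` is antitone; since `s = 0` is allowed and `f 0 = 0`, `H ≥ r 0`.

Let `d y = V y - V (y+1)` be the loss at a jump. As `(V y)' = H (d y)`, concavity of `V y` follows
once `d y` increases in time, and `(d y)' = H (d y) - H (d (y+1))` is nonnegative once `d y ≤ d
(y+1)`. At time 0 this convexity in the level is convexity of `c`. It persists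
(`IsValueFunction.convex`) by induction downwards from `ξ`: wherever `d y > d (y+1)`, antitonicity
gives `(d y)' ≤ 0`, while the level above gives `(d (y+1))' ≥ 0`, so `d (y+1) - d y` cannot decrease
while it is negative.

It remains to verify that `V` is the supremum over policies (`optimalProfit_eq`). Along a path, the
profit is `V x t` plus a telescoping sum of gains over the stages between jumps. Given the past, the
next jump is the first passage of the integrated intensity over an independent exponential level,
and `integral_firstPassage_eq` replaces it in the mean by its compensator. Each stage then has mean
gain at most 0 by definition of `H`, and nearly 0 if the policy nearly attains `H`. Almost surely
only `ξ - x + 1` stages matter. -/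

/-! ### The Hamiltonian -/

section Hamiltonian

/-- The maximal rate of gain over the controls `s ∈ S`, when the control `s` yields the gain `r s`
and causes with intensity `φ s` a loss `d`. -/
noncomputable def hamiltonian (S : Set ℝ) (φ r : ℝ → ℝ) (d : ℝ) : ℝ :=
  ⨆ s : S, (r s - φ s * d)

variable {S : Set ℝ} {φ r : ℝ → ℝ}

lemma le_hamiltonian (hS : IsCompact S) (hφ : ContinuousOn φ S) (hr : ContinuousOn r S)
    {s : ℝ} (hs : s ∈ S) (d : ℝ) : r s - φ s * d ≤ hamiltonian S φ r d := by
  have hb : BddAbove (Set.range fun s : S => r s - φ s * d) := by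
    have := hS.bddAbove_image (f := fun s => r s - φ s * d) (by fun_prop)
    rwa [Set.image_eq_range] at this
  exact le_ciSup hb ⟨s, hs⟩

lemma exists_hamiltonian_eq (hS : IsCompact S) (hne : S.Nonempty) (hφ : ContinuousOn φ S)
    (hr : ContinuousOn r S) (d : ℝ) : ∃ s ∈ S, hamiltonian S φ r d = r s - φ s * d := by
  obtain ⟨s, hs, hmax⟩ := hS.exists_isMaxOn hne (f := fun s => r s - φ s * d) (by fun_prop)
  refine ⟨s, hs, le_antisymm ?_ (le_hamiltonian hS hφ hr hs d)⟩
  have : Nonempty S := hne.to_subtype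
  exact ciSup_le fun s' => hmax s'.2

lemma antitone_hamiltonian (hS : IsCompact S) (hne : S.Nonempty) (hφ : ContinuousOn φ S)
    (hr : ContinuousOn r S) (hφ0 : ∀ s ∈ S, 0 ≤ φ s) : Antitone (hamiltonian S φ r) := by
  intro d d' hd
  obtain ⟨s, hs, h⟩ := exists_hamiltonian_eq hS hne hφ hr d'
  have := le_hamiltonian hS hφ hr hs d
  have := mul_le_mul_of_nonneg_left hd (hφ0 s hs)
  linarith

/-- A supremum of affine functions with slopes in `[-M, 0]` is `M`-Lipschitz: the maximizer at one
point serves as a competitor at the other. -/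
lemma abs_hamiltonian_sub_le (hS : IsCompact S) (hne : S.Nonempty) (hφ : ContinuousOn φ S)
    (hr : ContinuousOn r S) (hφ0 : ∀ s ∈ S, 0 ≤ φ s) {M : ℝ} (hM : ∀ s ∈ S, φ s ≤ M) (d d' : ℝ) :
    |hamiltonian S φ r d - hamiltonian S φ r d'| ≤ M * |d - d'| := by
  have key : ∀ a b : ℝ, hamiltonian S φ r a - hamiltonian S φ r b ≤ M * |a - b| := by
    intro a b
    obtain ⟨s, hs, h⟩ := exists_hamiltonian_eq hS hne hφ hr a
    have h1 := le_hamiltonian hS hφ hr hs b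
    have h2 : φ s * (b - a) ≤ φ s * |a - b| :=
      mul_le_mul_of_nonneg_left (by rw [abs_sub_comm]; exact le_abs_self _) (hφ0 s hs)
    have h3 := mul_le_mul_of_nonneg_right (hM s hs) (abs_nonneg (a - b))
    linarith
  rw [abs_sub_le_iff]
  exact ⟨key d d', by rw [abs_sub_comm]; exact key d' d⟩

end Hamiltonian

/-! ### Existence for the optimality equations -/

/-- A function that starts nonnegative and does not decrease while it is negative stays
nonnegative. -/
lemma nonneg_of_deriv_nonneg_of_neg {T : ℝ} {g g' : ℝ → ℝ} (hg : ContinuousOn g (Set.Icc 0 T))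
    (hd : ∀ t ∈ Set.Ioo 0 T, HasDerivAt g (g' t) t) (h0 : 0 ≤ g 0)
    (hneg : ∀ t ∈ Set.Ioo 0 T, g t < 0 → 0 ≤ g' t) {t : ℝ} (ht : t ∈ Set.Icc 0 T) : 0 ≤ g t := by
  by_contra! hlt
  have hsub : Set.Icc 0 t ⊆ Set.Icc 0 T := Set.Icc_subset_Icc_right ht.2
  have hcomp : IsCompact (Set.Icc 0 t ∩ g ⁻¹' Set.Ici 0) :=
    isCompact_Icc.of_isClosed_subset
      ((hg.mono hsub).preimage_isClosed_of_isClosed isClosed_Icc isClosed_Ici)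
      Set.inter_subset_left
  -- `s` is the last time up to `t` with `g ≥ 0`; after it `g` is negative, hence nondecreasing,
  -- which contradicts `g t < 0 ≤ g s`.
  obtain ⟨s, ⟨hs, hgs⟩, hmax⟩ := hcomp.exists_isGreatest ⟨0, ⟨le_rfl, ht.1⟩, h0⟩
  have hgs : 0 ≤ g s := hgs
  have hI : ∀ v ∈ Set.Ioo s t, v ∈ Set.Ioo 0 T := fun v hv =>
    ⟨hs.1.trans_lt hv.1, hv.2.trans_le ht.2⟩
  have hmono : MonotoneOn g (Set.Icc s t) := by
    refine monotoneOn_of_deriv_nonneg (convex_Icc s t)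
      (hg.mono (Set.Icc_subset_Icc hs.1 ht.2)) ?_ ?_ <;> rw [interior_Icc] <;> intro v hv
    · exact (hd v (hI v hv)).differentiableAt.differentiableWithinAt
    · rw [(hd v (hI v hv)).deriv]
      refine hneg v (hI v hv) ?_
      by_contra! h
      exact absurd (hmax ⟨⟨hs.1.trans hv.1.le, hv.2.le⟩, h⟩) (not_le.2 hv.1)
  have := hmono ⟨le_rfl, hs.2⟩ ⟨hs.2, le_rfl⟩ hs.2
  linarith

/-- Global existence for a scalar differential equation with a bounded Lipschitz right-hand side. -/
lemma exists_solution_of_bounded_lipschitz {F : ℝ → ℝ → ℝ} {L K : ℝ≥0}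
    (hF : ∀ y, Continuous fun t => F t y) (hK : ∀ t, LipschitzWith K (F t))
    (hL : ∀ t y, |F t y| ≤ L) {T : ℝ} (hT : 0 ≤ T) (v₀ : ℝ) :
    ∃ v : C(ℝ, ℝ), v 0 = v₀ ∧ (∀ t ∈ Set.Ioo 0 T, HasDerivAt v (F t (v t)) t) ∧
      ∃ C, ∀ t, |v t| ≤ C := by
  -- At speed at most `L` a solution cannot leave the ball of radius `L * T` before time `T`, so
  -- local existence already covers `[0, T]`.
  have hpl : IsPicardLindelof F (tmin := 0) (tmax := T) ⟨0, le_rfl, hT⟩ v₀ (L * T.toNNReal) 0 L K :=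
    { lipschitzOnWith := fun t _ => (hK t).lipschitzOnWith
      continuousOn := fun y _ => (hF y).continuousOn
      norm_le := fun t _ y _ => hL t y
      mul_max_le := by simp [hT] }
  obtain ⟨α, h0, hα⟩ := hpl.exists_eq_forall_mem_Icc_hasDerivWithinAt₀
  have hc : ContinuousOn α (Set.Icc 0 T) := fun t ht => (hα t ht).continuousWithinAt
  refine ⟨⟨Set.IccExtend hT ((Set.Icc 0 T).domRestrict α), hc.domRestrict.Icc_extend'⟩, ?_, ?_, ?_⟩
  · simpa [Set.IccExtend, Set.projIcc, hT] using h0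
  · intro t ht
    have hev : Set.IccExtend hT ((Set.Icc 0 T).domRestrict α) =ᶠ[nhds t] α := by
      filter_upwards [Icc_mem_nhds ht.1 ht.2] with s hs
      simp [Set.IccExtend_of_mem hT _ hs]
    have h1 := (hα t ⟨ht.1.le, ht.2.le⟩).hasDerivAt (Icc_mem_nhds ht.1 ht.2)
    have h2 := h1.congr_of_eventuallyEq hev
    rw [← hev.eq_of_nhds] at h2
    exact h2
  · obtain ⟨C, hC⟩ := isCompact_Icc.exists_bound_of_continuousOn hc
    exact ⟨C, fun t => hC _ (Set.projIcc 0 T hT t).2⟩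

/-- `V y t` is the solution of the optimality equations for the levels `y ≤ ξ` on the time interval
`[0, T]`. -/
structure IsValueFunction (S : Set ℝ) (φ r : ℝ → ℝ) (c : ℕ → ℝ) (ξ : ℕ) (T : ℝ)
    (V : ℕ → ℝ → ℝ) : Prop where
  continuous : ∀ y, Continuous (V y)
  bounded : ∀ y, ∃ C, ∀ t, |V y t| ≤ C
  zero : ∀ y ≤ ξ, V y 0 = -c y
  top : ∀ t ∈ Set.Ioo 0 T, HasDerivAt (V ξ) (r 0) t
  hasDerivAt : ∀ y < ξ, ∀ t ∈ Set.Ioo 0 T,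
    HasDerivAt (V y) (hamiltonian S φ r (V y t - V (y + 1) t)) t
  antitone : ∀ y < ξ, ∀ t ∈ Set.Icc 0 T, V (y + 1) t ≤ V y t

/-- `H` is unbounded on negative losses in general, so the equations are first solved with `H (max d
0)`, which lies between `r 0` and `H 0`. The truncation is then inactive: while `V y < V (y+1)`, the
derivative of `V y` is `H 0`, which bounds that of `V (y+1)`. -/
lemma exists_isValueFunction {S : Set ℝ} {φ r : ℝ → ℝ} (hS : IsCompact S) (h0S : (0 : ℝ) ∈ S)
    (hφ : ContinuousOn φ S) (hr : ContinuousOn r S) (hφ0 : ∀ s ∈ S, 0 ≤ φ s) (hφz : φ 0 = 0)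
    {c : ℕ → ℝ} {ξ : ℕ} (hc : MonotoneOn c (Set.Iic ξ)) {T : ℝ} (hT : 0 ≤ T) :
    ∃ V, IsValueFunction S φ r c ξ T V := by
  have hne : S.Nonempty := ⟨0, h0S⟩
  obtain ⟨M, hM⟩ := hS.bddAbove_image hφ
  have hM : ∀ s ∈ S, φ s ≤ M := fun s hs => hM ⟨s, hs, rfl⟩
  have hM0 : 0 ≤ M := hφz ▸ hM 0 h0S
  set H := hamiltonian S φ r with hH
  have hanti : Antitone H := antitone_hamiltonian hS hne hφ hr hφ0
  have hlow : ∀ d, r 0 ≤ H d := fun d => by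
    simpa [hφz] using le_hamiltonian hS hφ hr h0S d
  have hlip : LipschitzWith M.toNNReal H := by
    refine LipschitzWith.of_dist_le_mul fun d d' => ?_
    rw [Real.dist_eq, Real.dist_eq, Real.coe_toNNReal _ hM0]
    exact abs_hamiltonian_sub_le hS hne hφ hr hφ0 hM d d'
  set L : ℝ := max |r 0| |H 0| with hL
  have hbd : ∀ d, |H (max d 0)| ≤ L := fun d =>
    abs_le_max_abs_abs (hlow _) (hanti (le_max_right d 0))
  have hlipm : LipschitzWith M.toNNReal fun d => H (max d 0) := by
    have := hlip.comp ((LipschitzWith.id (α := ℝ)).max_const 0)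
    simpa [Function.comp_def] using this
  have hex : ∀ (b : C(ℝ, ℝ)) (v₀ : ℝ), ∃ v : C(ℝ, ℝ), v 0 = v₀ ∧
      (∀ t ∈ Set.Ioo 0 T, HasDerivAt v (H (max (v t - b t) 0)) t) ∧ ∃ C, ∀ t, |v t| ≤ C := by
    intro b v₀
    refine exists_solution_of_bounded_lipschitz (F := fun t y => H (max (y - b t) 0))
      (L := L.toNNReal) (K := M.toNNReal) ?_ ?_ ?_ hT v₀
    · intro y
      exact hlipm.continuous.comp (by fun_prop : Continuous fun t => y - b t)
    · intro t
      have := hlipm.comp (LipschitzWith.id.sub (LipschitzWith.const (b t)))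
      simpa [Function.comp_def] using this
    · intro t y
      exact (hbd _).trans (Real.le_coe_toNNReal _)
  choose sol hsol0 hsol hsolC using hex
  obtain ⟨W₀, hW₀, hW₀d, hW₀C⟩ := exists_solution_of_bounded_lipschitz
    (F := fun _ _ => r 0) (L := ‖r 0‖₊) (K := 0) (fun _ => continuous_const)
    (fun _ => LipschitzWith.const _) (fun _ _ => le_rfl) hT (-c ξ)
  -- `W k` belongs to level `ξ - k`: each level is driven by the one above it, so the recursion runs
  -- down from `ξ`.
  let W : ℕ → C(ℝ, ℝ) := fun k => Nat.rec (motive := fun _ => C(ℝ, ℝ))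
    W₀ (fun k b => sol b (-c (ξ - (k + 1)))) k
  have hWs : ∀ k, W (k + 1) = sol (W k) (-c (ξ - (k + 1))) := fun k => rfl
  have hVs : ∀ y < ξ, W (ξ - y) = sol (W (ξ - (y + 1))) (-c y) := by
    intro y hy
    have h1 : ξ - y = ξ - (y + 1) + 1 := by omega
    rw [h1, hWs]
    congr 3
    omega
  have hzero : ∀ y ≤ ξ, W (ξ - y) 0 = -c y := by
    intro y hy
    rcases hy.lt_or_eq with h | rfl
    · rw [hVs y h, hsol0]
    · simpa [W] using hW₀
  have htop : ∀ t ∈ Set.Ioo 0 T, HasDerivAt (W (ξ - ξ)) (r 0) t := by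
    intro t ht
    simpa [W] using hW₀d t ht
  have hbdd : ∀ k, ∃ C, ∀ t, |W k t| ≤ C := by
    rintro (_ | k)
    · exact hW₀C
    · exact hsolC _ _
  have hder : ∀ y < ξ, ∀ t ∈ Set.Ioo 0 T,
      HasDerivAt (W (ξ - y)) (H (max (W (ξ - y) t - W (ξ - (y + 1)) t) 0)) t := by
    intro y hy t ht
    have := hsol (W (ξ - (y + 1))) (-c y) t ht
    rwa [← hVs y hy] at this
  have hdle : ∀ y ≤ ξ, ∀ t ∈ Set.Ioo 0 T, ∃ w, HasDerivAt (W (ξ - y)) w t ∧ w ≤ H 0 := by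
    intro y hy t ht
    rcases hy.lt_or_eq with h | rfl
    · exact ⟨_, hder y h t ht, hanti (le_max_right _ _)⟩
    · exact ⟨_, htop t ht, hlow 0⟩
  have hord : ∀ y < ξ, ∀ t ∈ Set.Icc 0 T, W (ξ - (y + 1)) t ≤ W (ξ - y) t := by
    intro y hy t ht
    have hder' : ∀ t ∈ Set.Ioo 0 T,
        HasDerivAt (fun t => W (ξ - y) t - W (ξ - (y + 1)) t)
          (H (max (W (ξ - y) t - W (ξ - (y + 1)) t) 0) - deriv (W (ξ - (y + 1))) t) t := by
      intro t ht
      obtain ⟨w, hw, -⟩ := hdle (y + 1) hy t ht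
      exact (hder y hy t ht).sub (hw.deriv ▸ hw)
    have := nonneg_of_deriv_nonneg_of_neg (by fun_prop) hder' ?_ ?_ ht
    · linarith
    · rw [hzero y hy.le, hzero (y + 1) hy]
      have := hc (Set.mem_Iic.2 hy.le) (Set.mem_Iic.2 hy) (Nat.le_succ y)
      simp only [Nat.succ_eq_add_one] at this
      linarith
    · intro t ht hneg
      obtain ⟨w, hw, hw0⟩ := hdle (y + 1) hy t ht
      rw [hw.deriv, max_eq_right hneg.le]
      linarith
  -- For `y > ξ` truncated subtraction gives `W 0`, so continuity and boundedness hold at every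
  -- level; the last stage formally mentions level `ξ + 1`.
  refine ⟨fun y => W (ξ - y), ⟨fun y => (W _).continuous, fun y => hbdd _, hzero, htop, ?_, hord⟩⟩
  intro y hy t ht
  have := hder y hy t ht
  rwa [max_eq_left (by linarith [hord y hy t ⟨ht.1.le, ht.2.le⟩])] at this

/-! ### Convexity in the level and concavity in time -/

namespace IsValueFunction

variable {S : Set ℝ} {φ r : ℝ → ℝ} {c : ℕ → ℝ} {ξ : ℕ} {T : ℝ} {V : ℕ → ℝ → ℝ}

/-- The loss in value by an increment of the level is increasing in the level. -/
lemma convex (hV : IsValueFunction S φ r c ξ T V) (hanti : Antitone (hamiltonian S φ r))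
    (hlow : ∀ d, r 0 ≤ hamiltonian S φ r d)
    (hc : ∀ y, y + 2 ≤ ξ → c (y + 1) - c y ≤ c (y + 2) - c (y + 1)) :
    ∀ k y, y + 2 + k = ξ → ∀ t ∈ Set.Icc 0 T,
      V y t - V (y + 1) t ≤ V (y + 1) t - V (y + 2) t := by
  intro k
  induction k with
  | zero =>
    rintro y rfl t ht
    have := nonneg_of_deriv_nonneg_of_neg (T := T)
      (g := fun t => (V (y + 1) t - V (y + 2) t) - (V y t - V (y + 1) t))
      (g' := fun t => (hamiltonian S φ r (V (y + 1) t - V (y + 2) t) - r 0) -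
        (hamiltonian S φ r (V y t - V (y + 1) t) - hamiltonian S φ r (V (y + 1) t - V (y + 2) t)))
      ?_ ?_ ?_ ?_ ht
    · linarith
    · have := hV.continuous; fun_prop
    · intro t ht
      have h1 := hV.hasDerivAt (y + 1) (by omega) t ht
      exact (h1.sub (hV.top t ht)).sub ((hV.hasDerivAt y (by omega) t ht).sub h1)
    · rw [hV.zero _ (by omega), hV.zero _ (by omega), hV.zero _ (by omega)]
      linarith [hc y (by omega)]
    -- At the top, the loss at level `y + 1` has derivative `H d - r 0 ≥ 0`; in the inductive step
    -- below, `ih` plays the role of `hlow`.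
    · intro t ht h
      have h1 := hanti (by linarith : V (y + 1) t - V (y + 2) t ≤ V y t - V (y + 1) t)
      have h2 := hlow (V (y + 1) t - V (y + 2) t)
      linarith
  | succ k ih =>
    intro y hy t ht
    have := nonneg_of_deriv_nonneg_of_neg (T := T)
      (g := fun t => (V (y + 1) t - V (y + 2) t) - (V y t - V (y + 1) t))
      (g' := fun t => (hamiltonian S φ r (V (y + 1) t - V (y + 2) t) -
          hamiltonian S φ r (V (y + 2) t - V (y + 3) t)) -
        (hamiltonian S φ r (V y t - V (y + 1) t) - hamiltonian S φ r (V (y + 1) t - V (y + 2) t)))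
      ?_ ?_ ?_ ?_ ht
    · linarith
    · have := hV.continuous; fun_prop
    · intro t ht
      have h1 := hV.hasDerivAt (y + 1) (by omega) t ht
      exact (h1.sub (hV.hasDerivAt (y + 2) (by omega) t ht)).sub
        ((hV.hasDerivAt y (by omega) t ht).sub h1)
    · rw [hV.zero _ (by omega), hV.zero _ (by omega), hV.zero _ (by omega)]
      linarith [hc y (by omega)]
    · intro t ht h
      have h1 := hanti (by linarith : V (y + 1) t - V (y + 2) t ≤ V y t - V (y + 1) t)
      have h2 := hanti (ih (y + 1) (by omega) t ⟨ht.1.le, ht.2.le⟩)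
      linarith

/-- The derivative of `V y` is `H` of the loss and `H` is antitone, so it suffices that the loss
grows in time. This is `convex`, or `hlow` when `y + 1 = ξ`. At level `ξ` the derivative is
constant. -/
lemma concaveOn (hV : IsValueFunction S φ r c ξ T V) (hanti : Antitone (hamiltonian S φ r))
    (hlow : ∀ d, r 0 ≤ hamiltonian S φ r d)
    (hc : ∀ y, y + 2 ≤ ξ → c (y + 1) - c y ≤ c (y + 2) - c (y + 1)) {y : ℕ} (hy : y ≤ ξ) :
    ConcaveOn ℝ (Set.Icc 0 T) (V y) := by
  have hcont := hV.continuous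
  rcases hy.lt_or_eq with hlt | rfl
  · have hmono : MonotoneOn (fun t => V y t - V (y + 1) t) (Set.Icc 0 T) := by
      have hd : ∀ t ∈ Set.Ioo 0 T, ∃ w, HasDerivAt (fun t => V y t - V (y + 1) t) w t ∧ 0 ≤ w := by
        intro t ht
        rcases (Nat.succ_le_of_lt hlt).lt_or_eq with h | h
        · refine ⟨_, (hV.hasDerivAt y hlt t ht).sub (hV.hasDerivAt (y + 1) h t ht), sub_nonneg.2 ?_⟩
          obtain ⟨k, hk⟩ := Nat.exists_eq_add_of_le (Nat.succ_le_of_lt h)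
          exact hanti (hV.convex hanti hlow hc k y (by omega) t ⟨ht.1.le, ht.2.le⟩)
        · have h' : y + 1 = ξ := h
          exact ⟨_, (hV.hasDerivAt y hlt t ht).sub (h' ▸ hV.top t ht), sub_nonneg.2 (hlow _)⟩
      refine monotoneOn_of_deriv_nonneg (convex_Icc 0 T) (by fun_prop) ?_ ?_ <;>
        rw [interior_Icc] <;> intro t ht <;> obtain ⟨w, hw, hw0⟩ := hd t ht
      · exact hw.differentiableAt.differentiableWithinAt
      · rwa [hw.deriv]
    refine AntitoneOn.concaveOn_of_deriv (convex_Icc 0 T) (by fun_prop) ?_ ?_ <;>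
      rw [interior_Icc]
    · exact fun t ht => (hV.hasDerivAt y hlt t ht).differentiableAt.differentiableWithinAt
    · intro s hs t ht hst
      rw [(hV.hasDerivAt y hlt s hs).deriv, (hV.hasDerivAt y hlt t ht).deriv]
      exact hanti (hmono ⟨hs.1.le, hs.2.le⟩ ⟨ht.1.le, ht.2.le⟩ hst)
  · refine AntitoneOn.concaveOn_of_deriv (convex_Icc 0 T) (by fun_prop) ?_ ?_ <;>
      rw [interior_Icc]
    · exact fun t ht => (hV.top t ht).differentiableAt.differentiableWithinAt
    · intro s hs t ht _
      rw [(hV.top s hs).deriv, (hV.top t ht).deriv]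

end IsValueFunction

/-! ### First passage over an exponential level -/

instance : IsProbabilityMeasure (expMeasure 1) := isProbabilityMeasure_expMeasure one_pos

lemma expMeasure_one_eq :
    expMeasure 1 = (volume.restrict (Set.Ioi (0 : ℝ))).withDensity
      fun e => ENNReal.ofReal (Real.exp (-e)) := by
  rw [← withDensity_indicator measurableSet_Ioi]
  refine withDensity_congr_ae (f := exponentialPDF 1) ?_
  filter_upwards [compl_mem_ae_iff.2 (measure_singleton (0 : ℝ))] with e he
  rw [exponentialPDF_eq]
  rcases lt_or_gt_of_ne (show e ≠ 0 from he) with h | h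
  · simp [Set.indicator, h.le.not_gt, h.not_ge]
  · simp [Set.indicator, h, h.le]

lemma expMeasure_one_real_Ioi {a : ℝ} (ha : 0 ≤ a) :
    (expMeasure 1).real (Set.Ioi a) = Real.exp (-a) := by
  have h := cdf_expMeasure_eq one_pos a
  rw [cdf_eq_real, if_pos ha, one_mul] at h
  rw [← Set.compl_Iic, probReal_compl_eq_one_sub measurableSet_Iic, h]
  ring

lemma ae_expMeasure_one_pos : ∀ᵐ e ∂expMeasure 1, 0 < e := by
  rw [expMeasure_one_eq]
  refine (withDensity_absolutelyContinuous _ _).ae_le ?_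
  exact ae_restrict_mem measurableSet_Ioi

/-- The first passage time `m` of the integral of `q`, seen from the level at which it occurs, has
density `q`. -/
lemma map_firstPassage {T t : ℝ} (hTt : T ≤ t) {q : ℝ → ℝ} (hq : IntervalIntegrable q volume T t)
    (hq0 : ∀ v, 0 ≤ q v) {m : ℝ → ℝ} (hm : Measurable m)
    (hmT : ∀ e, T ≤ m e)
    (hmle : ∀ v ∈ Set.Icc T t, ∀ e ≤ ∫ w in T..t, q w, (m e ≤ v ↔ e ≤ ∫ w in T..v, q w)) :
    (volume.restrict (Set.Ioc 0 (∫ w in T..t, q w))).map m =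
      (volume.restrict (Set.Ioc T t)).withDensity fun v => ENNReal.ofReal (q v) := by
  have hsub : ∀ v ∈ Set.Icc T t, (∫ w in T..v, q w) ≤ ∫ w in T..t, q w := fun v hv =>
    intervalIntegral.integral_mono_interval le_rfl hv.1 hv.2
      (Filter.Eventually.of_forall hq0) hq
  have hfin : IsFiniteMeasure ((volume.restrict (Set.Ioc 0 (∫ w in T..t, q w))).map m) :=
    inferInstance
  have hval : ∀ v ∈ Set.Icc T t,
      (volume.restrict (Set.Ioc 0 (∫ w in T..t, q w))).map m (Set.Iic v) =
      (volume.restrict (Set.Ioc T t)).withDensity (fun v => ENNReal.ofReal (q v)) (Set.Iic v) := by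
    intro v hv
    rw [Measure.map_apply hm measurableSet_Iic,
      Measure.restrict_apply (hm measurableSet_Iic), withDensity_apply _ measurableSet_Iic,
      Measure.restrict_restrict measurableSet_Iic]
    have h1 : m ⁻¹' Set.Iic v ∩ Set.Ioc 0 (∫ w in T..t, q w) = Set.Ioc 0 (∫ w in T..v, q w) := by
      ext e
      constructor
      · rintro ⟨h, h0, h1⟩
        exact ⟨h0, (hmle v hv e h1).1 h⟩
      · rintro ⟨h0, h1⟩
        exact ⟨(hmle v hv e (h1.trans (hsub v hv))).2 h1, h0, h1.trans (hsub v hv)⟩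
    have h2 : Set.Iic v ∩ Set.Ioc T t = Set.Ioc T v := by
      ext w
      exact ⟨fun h => ⟨h.2.1, h.1⟩, fun h => ⟨h.2, h.1, h.2.trans hv.2⟩⟩
    rw [h1, h2, Real.volume_Ioc, sub_zero, intervalIntegral.integral_of_le hv.1,
      ofReal_integral_eq_lintegral_ofReal _ (Filter.Eventually.of_forall hq0)]
    exact ((intervalIntegrable_iff_integrableOn_Ioc_of_le hTt).1 hq).mono_set
      (Set.Ioc_subset_Ioc_right hv.2)
  -- Finite measures are determined by their distribution functions; on `[T, t]` both equal the
  -- integral of `q` from `T` to `v`.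
  refine Measure.ext_of_Iic _ _ fun v => ?_
  rcases lt_or_ge v T with hv | hv
  · rw [Measure.map_apply hm measurableSet_Iic, withDensity_apply _ measurableSet_Iic,
      Measure.restrict_restrict measurableSet_Iic]
    have h1 : m ⁻¹' Set.Iic v = ∅ := by
      ext e
      simpa using hv.trans_le (hmT e)
    have h2 : Set.Iic v ∩ Set.Ioc T t = ∅ := by
      ext w
      simp only [Set.mem_inter_iff, Set.mem_Iic, Set.mem_Ioc, Set.mem_empty_iff_false, iff_false]
      intro h
      linarith [h.1, h.2.1]
    simp [h1, h2]
  · rcases le_or_gt v t with hvt | hvt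
    · exact hval v ⟨hv, hvt⟩
    · have h := hval t ⟨hTt, le_rfl⟩
      rw [Measure.map_apply hm measurableSet_Iic,
        Measure.restrict_apply (hm measurableSet_Iic), withDensity_apply _ measurableSet_Iic,
        Measure.restrict_restrict measurableSet_Iic] at h ⊢
      have h1 : m ⁻¹' Set.Iic v ∩ Set.Ioc 0 (∫ w in T..t, q w) =
          m ⁻¹' Set.Iic t ∩ Set.Ioc 0 (∫ w in T..t, q w) := by
        ext e
        refine and_congr_left fun he => ?_
        have : m e ≤ t := (hmle t ⟨hTt, le_rfl⟩ e he.2).2 he.2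
        exact ⟨fun _ => this, fun h => le_trans h hvt.le⟩
      have h2 : Set.Iic v ∩ Set.Ioc T t = Set.Iic t ∩ Set.Ioc T t := by
        ext w
        exact ⟨fun h => ⟨h.2.2, h.2⟩, fun h => ⟨h.2.2.trans hvt.le, h.2⟩⟩
      rw [h1, h2, h]

/-- The compensator of a single jump: if a jump with intensity `q` occurs at the time `m e`, where
`e` has a unit exponential law, then the jump of size `ψ` before time `t` has the same mean as the
integral of `q * ψ` up to the jump. -/
lemma integral_firstPassage_eq {T t : ℝ} (hTt : T ≤ t) {q ψ : ℝ → ℝ} {M C : ℝ}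
    (hq : Measurable q) (hq0 : ∀ v, 0 ≤ q v) (hqM : ∀ v, q v ≤ M)
    (hψ : Measurable ψ) (hψC : ∀ v, |ψ v| ≤ C) {m : ℝ → ℝ} (hm : Measurable m)
    (hmI : ∀ e, m e ∈ Set.Icc T t)
    (hmle : ∀ v ∈ Set.Icc T t, ∀ e ≤ ∫ w in T..t, q w, (m e ≤ v ↔ e ≤ ∫ w in T..v, q w))
    (hmt : ∀ e, (∫ w in T..t, q w) < e → m e = t) :
    ∫ e, (Set.Iic (∫ w in T..t, q w)).indicator (fun e => ψ (m e)) e ∂expMeasure 1 =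
      ∫ e, (∫ v in T..m e, q v * ψ v) ∂expMeasure 1 := by
  set Λ : ℝ → ℝ := fun v => ∫ w in T..v, q w with hΛ
  have hqi : ∀ a b, IntervalIntegrable q volume a b := fun a b =>
    (intervalIntegrable_const (c := M)).mono_fun hq.aestronglyMeasurable
      (Filter.Eventually.of_forall fun v => by
        simpa [abs_of_nonneg (hq0 v), abs_of_nonneg ((hq0 v).trans (hqM v))] using hqM v)
  have hΛc : Continuous Λ := intervalIntegral.continuous_primitive hqi T
  have hΛmono : Monotone Λ := by
    intro a b hab
    have : Λ b - Λ a = ∫ w in a..b, q w :=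
      intervalIntegral.integral_interval_sub_left (hqi _ _) (hqi _ _)
    have := intervalIntegral.integral_nonneg (μ := volume) hab fun v _ => hq0 v
    linarith
  have hΛT : Λ T = 0 := by simp [hΛ]
  -- `Λ` is continuous, so it does not overshoot the level at the passage; the weight `exp (-e)`
  -- thus becomes `exp (-Λ (m e))`.
  have hΛm : ∀ e ∈ Set.Ioc 0 (Λ t), Λ (m e) = e := by
    intro e he
    refine le_antisymm ?_ ((hmle (m e) (hmI e) e he.2).1 le_rfl)
    by_contra! hlt
    obtain ⟨v, hv, hve⟩ := intermediate_value_Icc (hmI e).1 hΛc.continuousOn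
      (show e ∈ Set.Icc (Λ T) (Λ (m e)) from ⟨hΛT ▸ he.1.le, hlt.le⟩)
    have h1 : m e ≤ v := (hmle v ⟨hv.1, hv.2.trans (hmI e).2⟩ e he.2).2 hve.ge
    have : v = m e := le_antisymm hv.2 h1
    rw [this] at hve
    linarith
  have hmid : ∫ e in Set.Ioc 0 (Λ t), Real.exp (-Λ (m e)) * ψ (m e) =
      ∫ v in Set.Ioc T t, q v * (Real.exp (-Λ v) * ψ v) := by
    have h := map_firstPassage hTt (hqi T t) hq0 hm (fun e => (hmI e).1) hmle
    have hmeas : Measurable fun v => Real.exp (-Λ v) * ψ v :=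
      (Real.measurable_exp.comp hΛc.measurable.neg).mul hψ
    rw [← integral_map (φ := m) (f := fun v => Real.exp (-Λ v) * ψ v) hm.aemeasurable
      hmeas.aestronglyMeasurable, h,
      integral_withDensity_eq_integral_toReal_smul (by fun_prop)
        (Filter.Eventually.of_forall fun _ => ENNReal.ofReal_lt_top)]
    simp [ENNReal.toReal_ofReal (hq0 _)]
  have hleft : ∫ e, (Set.Iic (Λ t)).indicator (fun e => ψ (m e)) e ∂expMeasure 1 =
      ∫ e in Set.Ioc 0 (Λ t), Real.exp (-Λ (m e)) * ψ (m e) := by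
    rw [expMeasure_one_eq, integral_withDensity_eq_integral_toReal_smul (by fun_prop)
        (Filter.Eventually.of_forall fun _ => ENNReal.ofReal_lt_top)]
    simp only [ENNReal.toReal_ofReal (Real.exp_nonneg _), smul_eq_mul]
    rw [← integral_indicator measurableSet_Ioi, ← integral_indicator measurableSet_Ioc]
    congr 1
    ext e
    by_cases h0 : 0 < e <;> by_cases h1 : e ≤ Λ t
    · simp [Set.indicator, h0, h1, hΛm e ⟨h0, h1⟩]
    all_goals simp [Set.indicator, h0, h1]
  -- By Fubini: no jump has occurred by time `v` exactly when `e > Λ v`, an event of probability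
  -- `exp (-Λ v)`.
  have hright : ∫ e, (∫ v in T..m e, q v * ψ v) ∂expMeasure 1 =
      ∫ v in Set.Ioc T t, q v * (Real.exp (-Λ v) * ψ v) := by
    -- The endpoint `t` is left out because `m` is capped there.
    have hlt : ∀ v ∈ Set.Ioo T t, ∀ e, v < m e ↔ Λ v < e := by
      intro v hv e
      rcases le_or_gt e (Λ t) with he | he
      · rw [← not_le, ← not_le, hmle v ⟨hv.1.le, hv.2.le⟩ e he]
      · rw [hmt e he]
        exact ⟨fun _ => (hΛmono hv.2.le).trans_lt he, fun _ => hv.2⟩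
    have h1 : ∀ e, ∫ v in T..m e, q v * ψ v =
        ∫ v in Set.Ioo T t, {p : ℝ × ℝ | Λ p.2 < p.1}.indicator (fun p => q p.2 * ψ p.2) (e, v) := by
      intro e
      rw [intervalIntegral.integral_of_le (hmI e).1, integral_Ioc_eq_integral_Ioo,
        ← integral_indicator measurableSet_Ioo, ← integral_indicator measurableSet_Ioo]
      congr 1
      ext v
      by_cases hv : v ∈ Set.Ioo T t
      · rw [Set.indicator_of_mem hv]
        simp only [Set.indicator, Set.mem_ofPred_eq, Set.mem_Ioo, hlt v hv e, hv.1, true_and]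
      · rw [Set.indicator_of_notMem hv, Set.indicator_of_notMem]
        exact fun h => hv ⟨h.1, h.2.trans_le (hmI e).2⟩
    have hms : MeasurableSet {p : ℝ × ℝ | Λ p.2 < p.1} :=
      measurableSet_lt (hΛc.measurable.comp measurable_snd) measurable_fst
    have hint : Integrable (Function.uncurry fun e v =>
        {p : ℝ × ℝ | Λ p.2 < p.1}.indicator (fun p => q p.2 * ψ p.2) (e, v))
        ((expMeasure 1).prod (volume.restrict (Set.Ioo T t))) := by
      refine Integrable.of_bound (C := M * C) ?_ (Filter.Eventually.of_forall ?_)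
      · exact (((hq.comp measurable_snd).mul (hψ.comp measurable_snd)).indicator
          hms).aestronglyMeasurable
      · rintro ⟨e, v⟩
        refine (norm_indicator_le_norm_self (fun p : ℝ × ℝ => q p.2 * ψ p.2) (e, v)).trans ?_
        rw [norm_mul, Real.norm_eq_abs, Real.norm_eq_abs, abs_of_nonneg (hq0 v)]
        exact mul_le_mul (hqM v) (hψC v) (abs_nonneg _) ((hq0 v).trans (hqM v))
    simp only [h1]
    rw [integral_integral_swap hint, integral_Ioc_eq_integral_Ioo]
    refine setIntegral_congr_fun measurableSet_Ioo fun v hv => ?_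
    have h2 : ∀ e, {p : ℝ × ℝ | Λ p.2 < p.1}.indicator (fun p => q p.2 * ψ p.2) (e, v) =
        (Set.Ioi (Λ v)).indicator (fun _ => q v * ψ v) e := fun e => rfl
    have h3 : 0 ≤ Λ v := hΛT ▸ hΛmono hv.1.le
    simp only [h2]
    rw [integral_indicator_const _ measurableSet_Ioi, expMeasure_one_real_Ioi h3, smul_eq_mul]
    ring
  rw [hleft, hmid, hright]

/-- Verification of one stage: until the jump, with intensity `q`, revenue accrues at rate `ρ`, and
at the jump the value drops from `v₀` to `v₁`. If the gain is at most the rate `D` at which the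
value `v₀` grows, and at least `D - δ`, then the total expected gain is nearly zero. -/
lemma integral_stage_mem_Icc {T t T₀ : ℝ} (h0T : 0 ≤ T) (hTt : T ≤ t) (htT : t ≤ T₀)
    {ρ q v₀ v₁ D : ℝ → ℝ} {R M C₀ C₁ δ : ℝ}
    (hρ : Measurable ρ) (hρR : ∀ v, |ρ v| ≤ R)
    (hq : Measurable q) (hq0 : ∀ v, 0 ≤ q v) (hqM : ∀ v, q v ≤ M)
    (hv₀ : Continuous v₀) (hvC₀ : ∀ v, |v₀ v| ≤ C₀) (hv₁ : Continuous v₁)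
    (hvC₁ : ∀ v, |v₁ v| ≤ C₁) (hDc : Continuous D)
    (hD : ∀ v ∈ Set.Ioo 0 T₀, HasDerivAt v₀ (D v) v) (hδ : 0 ≤ δ)
    (hgap : ∀ v ∈ Set.Ioo T t,
      ρ v + q v * (v₁ (t - v) - v₀ (t - v)) - D (t - v) ∈ Set.Icc (-δ) 0)
    {m : ℝ → ℝ} (hm : Measurable m) (hmI : ∀ e, m e ∈ Set.Icc T t)
    (hmle : ∀ v ∈ Set.Icc T t, ∀ e ≤ ∫ w in T..t, q w, (m e ≤ v ↔ e ≤ ∫ w in T..v, q w))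
    (hmt : ∀ e, (∫ w in T..t, q w) < e → m e = t) :
    ∫ e, ((∫ v in T..m e, ρ v) + (if e ≤ ∫ w in T..t, q w then v₁ (t - m e) else v₀ 0)
      - v₀ (t - T)) ∂expMeasure 1 ∈ Set.Icc (-(δ * t)) 0 := by
  have hii : ∀ {g : ℝ → ℝ} {B : ℝ}, Measurable g → (∀ v, |g v| ≤ B) →
      ∀ a b, IntervalIntegrable g volume a b := fun {g B} hg hB a b =>
    (intervalIntegrable_const (c := B)).mono_fun hg.aestronglyMeasurable
      (Filter.Eventually.of_forall fun v => by
        simpa [abs_of_nonneg ((abs_nonneg _).trans (hB v))] using hB v)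
  have hR0 : 0 ≤ R := (abs_nonneg _).trans (hρR 0)
  have hM0 : 0 ≤ M := (hq0 0).trans (hqM 0)
  have hC₀ : 0 ≤ C₀ := (abs_nonneg _).trans (hvC₀ 0)
  have hC₁ : 0 ≤ C₁ := (abs_nonneg _).trans (hvC₁ 0)
  set ψ : ℝ → ℝ := fun v => v₁ (t - v) - v₀ (t - v) with hψ
  have hψc : Continuous ψ := by fun_prop
  have hψC : ∀ v, |ψ v| ≤ C₁ + C₀ := fun v =>
    (abs_sub _ _).trans (add_le_add (hvC₁ _) (hvC₀ _))
  have hqψm : Measurable fun v => q v * ψ v := hq.mul hψc.measurable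
  have hqψC : ∀ v, |q v * ψ v| ≤ M * (C₁ + C₀) := fun v => by
    rw [abs_mul, abs_of_nonneg (hq0 v)]
    exact mul_le_mul (hqM v) (hψC v) (abs_nonneg _) hM0
  have hprim : ∀ {g : ℝ → ℝ} {B : ℝ}, Measurable g → (∀ v, |g v| ≤ B) →
      Integrable (fun e => ∫ v in T..m e, g v) (expMeasure 1) := by
    intro g B hg hB
    refine Integrable.of_bound (C := B * (t - T)) ?_ (Filter.Eventually.of_forall fun e => ?_)
    · exact ((intervalIntegral.continuous_primitive (hii hg hB) T).measurable.comp
        hm).aestronglyMeasurable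
    · refine (intervalIntegral.norm_integral_le_of_norm_le_const fun v _ => hB v).trans ?_
      rw [abs_of_nonneg (by linarith [(hmI e).1])]
      exact mul_le_mul_of_nonneg_left (by linarith [(hmI e).2]) ((abs_nonneg _).trans (hB 0))
  have hcomp := integral_firstPassage_eq hTt hq hq0 hqM hψc.measurable hψC hm hmI hmle hmt
  have hi1 : Integrable (fun e => (∫ v in T..m e, ρ v) + (v₀ (t - m e) - v₀ (t - T)))
      (expMeasure 1) := by
    refine (hprim hρ hρR).add (Integrable.of_bound (C := C₀ + C₀) ?_
      (Filter.Eventually.of_forall fun e => ?_))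
    · exact ((hv₀.measurable.comp (measurable_const.sub hm)).sub_const _).aestronglyMeasurable
    · exact (abs_sub _ _).trans (add_le_add (hvC₀ _) (hvC₀ _))
  have hi2 : Integrable (fun e => (Set.Iic (∫ w in T..t, q w)).indicator (fun e => ψ (m e)) e)
      (expMeasure 1) := by
    refine Integrable.indicator (Integrable.of_bound (C := C₁ + C₀) ?_
      (Filter.Eventually.of_forall fun e => hψC _)) measurableSet_Iic
    exact (hψc.measurable.comp hm).aestronglyMeasurable
  -- With a jump, `v₁ = v₀ + ψ` at the remaining time; without one, `m e = t` and the value is `v₀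
  -- 0`.
  have hsplit : ∀ e, (∫ v in T..m e, ρ v) +
      (if e ≤ ∫ w in T..t, q w then v₁ (t - m e) else v₀ 0) - v₀ (t - T) =
      ((∫ v in T..m e, ρ v) + (v₀ (t - m e) - v₀ (t - T))) +
        (Set.Iic (∫ w in T..t, q w)).indicator (fun e => ψ (m e)) e := by
    intro e
    by_cases he : e ≤ ∫ w in T..t, q w
    · simp only [if_pos he, Set.indicator, Set.mem_Iic, hψ]
      ring
    · simp only [if_neg he, Set.indicator, Set.mem_Iic, hmt e (not_le.1 he), sub_self]
      ring
  simp only [hsplit]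
  rw [integral_add hi1 hi2, hcomp, ← integral_add hi1 (hprim hqψm hqψC)]
  -- Once the jump is replaced by its compensator, the gain is for every `e` the integral over `[T,
  -- m e]` of the gap in `hgap`.
  have hpt : ∀ e, ((∫ v in T..m e, ρ v) + (v₀ (t - m e) - v₀ (t - T))) +
      (∫ v in T..m e, q v * ψ v) ∈ Set.Icc (-(δ * t)) 0 := by
    intro e
    have hDi : IntervalIntegrable (fun v => -D (t - v)) volume T (m e) :=
      Continuous.intervalIntegrable (by fun_prop) _ _
    have hftc : ∫ v in T..m e, -D (t - v) = v₀ (t - m e) - v₀ (t - T) := by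
      refine intervalIntegral.integral_eq_sub_of_hasDerivAt_of_le (f := fun v => v₀ (t - v))
        (hmI e).1 (by fun_prop) (fun v hv => ?_) hDi
      have h1 := hD (t - v) ⟨by linarith [hv.2, (hmI e).2], by linarith [hv.1]⟩
      simpa [Function.comp_def] using h1.comp v ((hasDerivAt_id v).const_sub t)
    have hsum : ((∫ v in T..m e, ρ v) + (v₀ (t - m e) - v₀ (t - T))) +
        (∫ v in T..m e, q v * ψ v) = ∫ v in T..m e, (ρ v + -D (t - v) + q v * ψ v) := by
      rw [intervalIntegral.integral_add ((hii hρ hρR _ _).add hDi) (hii hqψm hqψC _ _),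
        intervalIntegral.integral_add (hii hρ hρR _ _) hDi, hftc]
    have hint : IntervalIntegrable (fun v => ρ v + -D (t - v) + q v * ψ v) volume T (m e) :=
      ((hii hρ hρR _ _).add hDi).add (hii hqψm hqψC _ _)
    rw [hsum]
    have hg : ∀ v ∈ Set.Ioo T (m e), ρ v + -D (t - v) + q v * ψ v ∈ Set.Icc (-δ) 0 := by
      intro v hv
      have := hgap v ⟨hv.1, hv.2.trans_le (hmI e).2⟩
      rwa [show ρ v + -D (t - v) + q v * ψ v = ρ v + q v * ψ v - D (t - v) by ring]
    constructor
    · have h1 : ∫ _ in T..m e, -δ ≤ ∫ v in T..m e, (ρ v + -D (t - v) + q v * ψ v) :=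
        intervalIntegral.integral_mono_on_of_le_Ioo (hmI e).1 intervalIntegrable_const hint
          fun v hv => (hg v hv).1
      rw [intervalIntegral.integral_const, smul_eq_mul] at h1
      have h2 : (m e - T) * δ ≤ t * δ :=
        mul_le_mul_of_nonneg_right (by linarith [(hmI e).2]) hδ
      linarith
    · have h1 : ∫ v in T..m e, (ρ v + -D (t - v) + q v * ψ v) ≤ ∫ _ in T..m e, 0 :=
        intervalIntegral.integral_mono_on_of_le_Ioo (hmI e).1 hint intervalIntegrable_const
          fun v hv => (hg v hv).2
      simpa using h1
  refine ⟨?_, integral_nonpos fun e => (hpt e).2⟩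
  have := integral_mono (integrable_const (-(δ * t))) (hi1.add (hprim hqψm hqψC))
    fun e => (hpt e).1
  simpa using this

/-- Measurable dependence of an interval integral on a parameter, in the bounds and the
integrand. -/
lemma measurable_intervalIntegral {α : Type*} [MeasurableSpace α] {a b : α → ℝ}
    (ha : Measurable a) (hb : Measurable b) {g : α × ℝ → ℝ} (hg : Measurable g) :
    Measurable fun p => ∫ v in a p..b p, g (p, v) := by
  have key : ∀ {a b : α → ℝ}, Measurable a → Measurable b →
      Measurable fun p => ∫ v in Set.Ioc (a p) (b p), g (p, v) := by
    intro a b ha hb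
    have hs : MeasurableSet {z : α × ℝ | a z.1 < z.2 ∧ z.2 ≤ b z.1} :=
      (measurableSet_lt (ha.comp measurable_fst) measurable_snd).inter
        (measurableSet_le measurable_snd (hb.comp measurable_fst))
    have h : StronglyMeasurable fun p => ∫ v, ({z : α × ℝ | a z.1 < z.2 ∧ z.2 ≤ b z.1}.indicator
        g) (p, v) := (hg.indicator hs).stronglyMeasurable.integral_prod_right'
    convert h.measurable using 2 with p
    rw [← integral_indicator measurableSet_Ioc]
    rfl
  simp only [intervalIntegral]
  exact (key ha hb).sub (key hb ha)

/-! ### Increment times: measurability and independence -/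

namespace ProductionPolicy

variable {sbar : ℝ} {ξ x : ℕ}

lemma measurable_lastTime : ∀ n, Measurable (lastTime : (Fin n → ℝ≥0∞) → ℝ≥0∞)
  | 0 => measurable_const
  | n + 1 => measurable_pi_apply (Fin.last n)

/-- `g` is controlled only on `[0, sbar]`; the rates stay there, so `g` may be replaced by its
continuous extension. -/
lemma measurable_comp_rate {g : ℝ → ℝ} (hg : ContinuousOn g (Set.Icc 0 sbar))
    (u : ProductionPolicy sbar ξ x) (n : ℕ) :
    Measurable fun p : (Fin n → ℝ≥0∞) × ℝ => g (u.rate n (fun i => (p.1 i).toReal) p.2) := by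
  have hs : (0 : ℝ) ≤ sbar := (u.rate_mem 0 Fin.elim0 0).1.trans (u.rate_mem 0 Fin.elim0 0).2
  have h1 : Measurable fun p : (Fin n → ℝ≥0∞) × ℝ => u.rate n (fun i => (p.1 i).toReal) p.2 := by
    refine (u.measurable_rate n).comp (Measurable.prodMk ?_ measurable_snd)
    exact measurable_pi_lambda _ fun i =>
      ((measurable_pi_apply i).comp measurable_fst).ennreal_toReal
  have h2 := (hg.domRestrict.Icc_extend' (h := hs)).measurable.comp h1
  convert h2 using 2 with p
  exact (Set.IccExtend_of_mem hs ((Set.Icc 0 sbar).domRestrict g)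
    (u.rate_mem n (fun i => (p.1 i).toReal) p.2)).symm

lemma measurable_comp_rate_apply {g : ℝ → ℝ} (hg : ContinuousOn g (Set.Icc 0 sbar))
    (u : ProductionPolicy sbar ξ x) {n : ℕ} (h : Fin n → ℝ≥0∞) :
    Measurable fun v => g (u.rate n (fun i => (h i).toReal) v) :=
  (measurable_comp_rate hg u n).comp (measurable_const.prodMk measurable_id)

lemma exists_abs_comp_rate_le {g : ℝ → ℝ} (hg : ContinuousOn g (Set.Icc 0 sbar)) :
    ∃ R, 0 ≤ R ∧ ∀ (u : ProductionPolicy sbar ξ x) (n : ℕ) (h : Fin n → ℝ) (v : ℝ),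
      |g (u.rate n h v)| ≤ R := by
  obtain ⟨R, hR⟩ := isCompact_Icc.exists_bound_of_continuousOn hg
  exact ⟨max R 0, le_max_right _ _, fun u n h v =>
    (hR _ (u.rate_mem n h v)).trans (le_max_left _ _)⟩

lemma intervalIntegrable_comp_rate {g : ℝ → ℝ} (hg : ContinuousOn g (Set.Icc 0 sbar))
    (u : ProductionPolicy sbar ξ x) {n : ℕ} (h : Fin n → ℝ≥0∞) (a b : ℝ) :
    IntervalIntegrable (fun v => g (u.rate n (fun i => (h i).toReal) v)) volume a b := by
  obtain ⟨R, hR0, hR⟩ := exists_abs_comp_rate_le (ξ := ξ) (x := x) hg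
  refine (intervalIntegrable_const (c := R)).mono_fun
    (measurable_comp_rate_apply hg u h).aestronglyMeasurable (Filter.Eventually.of_forall fun v => ?_)
  simpa [abs_of_nonneg hR0] using hR u n _ v

section Times

variable {f : ℝ → ℝ} {lam : ℝ}

lemma lastTime_le_nextTime (u : ProductionPolicy sbar ξ x) {n : ℕ} (h : Fin n → ℝ≥0∞) (e : ℝ) :
    lastTime h ≤ nextTime f lam u h e :=
  le_iInf₂ fun _ hτ => hτ.1

/-- The infimum is attained, because the integrated intensity is continuous, and every later time
qualifies too, because the intensity is nonnegative. -/
lemma nextTime_le_iff (hf : ContinuousOn f (Set.Icc 0 sbar)) (hf0 : ∀ s ∈ Set.Icc 0 sbar, 0 ≤ f s)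
    (hlam : 0 ≤ lam) (u : ProductionPolicy sbar ξ x) {n : ℕ} (h : Fin n → ℝ≥0∞) (e : ℝ) (v : ℝ≥0) :
    nextTime f lam u h e ≤ v ↔ lastTime h ≤ v ∧
      e ≤ ∫ w in (lastTime h).toReal..v, lam * f (u.rate n (fun i => (h i).toReal) w) := by
  refine ⟨fun hle => ?_, fun hv => iInf₂_le v hv⟩
  set q : ℝ → ℝ := fun w => lam * f (u.rate n (fun i => (h i).toReal) w) with hq
  have hqi : ∀ a b, IntervalIntegrable q volume a b := fun a b =>
    (intervalIntegrable_comp_rate hf u h a b).const_mul lam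
  set A : Set ℝ≥0 := {τ | lastTime h ≤ τ ∧ e ≤ ∫ w in (lastTime h).toReal..τ, q w} with hA
  have hN : nextTime f lam u h e = ⨅ τ ∈ A, (τ : ℝ≥0∞) := rfl
  have hne : A.Nonempty := by
    by_contra! hemp
    rw [hN, hemp] at hle
    simp at hle
  have hclosed : IsClosed A := by
    have hc : Continuous fun τ : ℝ≥0 => ∫ w in (lastTime h).toReal..τ, q w :=
      (intervalIntegral.continuous_primitive hqi _).comp NNReal.continuous_coe
    exact (isClosed_le continuous_const ENNReal.continuous_coe).inter
      (isClosed_le continuous_const hc)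
  have hmem : sInf A ∈ A := hclosed.csInf_mem hne (OrderBot.bddBelow A)
  rw [hN, ← ENNReal.coe_sInf hne, ENNReal.coe_le_coe] at hle
  refine ⟨hmem.1.trans (ENNReal.coe_le_coe.2 hle), hmem.2.trans ?_⟩
  have h1 : (∫ w in (lastTime h).toReal..v, q w) - ∫ w in (lastTime h).toReal..(sInf A : ℝ≥0), q w
      = ∫ w in (sInf A : ℝ≥0)..v, q w :=
    intervalIntegral.integral_interval_sub_left (hqi _ _) (hqi _ _)
  have h2 : 0 ≤ ∫ w in ((sInf A : ℝ≥0) : ℝ)..v, q w :=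
    intervalIntegral.integral_nonneg (NNReal.coe_le_coe.2 hle) fun w _ =>
      mul_nonneg hlam (hf0 _ (u.rate_mem _ _ _))
  linarith

lemma measurable_nextTime (hf : ContinuousOn f (Set.Icc 0 sbar))
    (hf0 : ∀ s ∈ Set.Icc 0 sbar, 0 ≤ f s) (hlam : 0 ≤ lam) (u : ProductionPolicy sbar ξ x) (n : ℕ) :
    Measurable fun p : (Fin n → ℝ≥0∞) × ℝ => nextTime f lam u p.1 p.2 := by
  refine measurable_of_Iic fun a => ?_
  induction a using ENNReal.recTopCoe with
  | top => simp
  | coe v =>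
    have hset : (fun p : (Fin n → ℝ≥0∞) × ℝ => nextTime f lam u p.1 p.2) ⁻¹' Set.Iic (v : ℝ≥0∞) =
        {p | lastTime p.1 ≤ v ∧ p.2 ≤ ∫ w in (lastTime p.1).toReal..v,
          lam * f (u.rate n (fun i => (p.1 i).toReal) w)} := by
      ext p
      exact nextTime_le_iff hf hf0 hlam u p.1 p.2 v
    rw [hset]
    have h1 : Measurable fun p : (Fin n → ℝ≥0∞) × ℝ => lastTime p.1 :=
      (measurable_lastTime n).comp measurable_fst
    refine (measurableSet_le h1 measurable_const).inter (measurableSet_le measurable_snd ?_)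
    exact measurable_intervalIntegral (g := fun z : ((Fin n → ℝ≥0∞) × ℝ) × ℝ =>
      lam * f (u.rate n (fun i => (z.1.1 i).toReal) z.2)) h1.ennreal_toReal measurable_const
      (((measurable_comp_rate hf u n).comp
        ((measurable_fst.comp measurable_fst).prodMk measurable_snd)).const_mul lam)

lemma incrementTimes_succ_last (u : ProductionPolicy sbar ξ x) (E : ℕ → ℝ) (n : ℕ) :
    incrementTimes f lam u E (n + 1) (Fin.last n) =
      nextTime f lam u (incrementTimes f lam u E n) (E n) :=
  Fin.snoc_last (α := fun _ => ℝ≥0∞) _ _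

lemma incrementTimes_succ_castSucc (u : ProductionPolicy sbar ξ x) (E : ℕ → ℝ) (n : ℕ)
    (i : Fin n) : incrementTimes f lam u E (n + 1) i.castSucc = incrementTimes f lam u E n i :=
  Fin.snoc_castSucc (α := fun _ => ℝ≥0∞) _ _ i

lemma measurable_incrementTimes (hf : ContinuousOn f (Set.Icc 0 sbar))
    (hf0 : ∀ s ∈ Set.Icc 0 sbar, 0 ≤ f s) (hlam : 0 ≤ lam) (u : ProductionPolicy sbar ξ x) (n : ℕ) :
    Measurable fun E => incrementTimes f lam u E n := by
  induction n with
  | zero => exact measurable_const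
  | succ n ih =>
    refine measurable_pi_lambda _ fun i => ?_
    induction i using Fin.lastCases with
    | last =>
      simp only [incrementTimes_succ_last]
      exact (measurable_nextTime hf hf0 hlam u n).comp
        (g := fun p : (Fin n → ℝ≥0∞) × ℝ => nextTime f lam u p.1 p.2)
        (f := fun E : ℕ → ℝ => (incrementTimes f lam u E n, E n))
        (ih.prodMk (measurable_pi_apply n))
    | cast i =>
      simp only [incrementTimes_succ_castSucc]
      exact measurable_pi_iff.1 ih i

/-- Non-anticipation: `E n` does not enter the first `n` times. This yields the independence below.
-/
lemma incrementTimes_congr (u : ProductionPolicy sbar ξ x) {E E' : ℕ → ℝ} :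
    ∀ n, (∀ i < n, E i = E' i) → incrementTimes f lam u E n = incrementTimes f lam u E' n
  | 0, _ => rfl
  | n + 1, h => by
    simp only [incrementTimes]
    rw [incrementTimes_congr u n fun i hi => h i (by omega), h n (by omega)]

instance : IsProbabilityMeasure noise := by
  unfold noise
  infer_instance

lemma map_noise_eval (n : ℕ) : noise.map (fun E => E n) = expMeasure 1 :=
  Measure.infinitePi_map_eval (fun _ : ℕ => expMeasure 1) n

/-- The driving variable of the next increment is independent of the past increments. -/
lemma map_noise_incrementTimes (hf : ContinuousOn f (Set.Icc 0 sbar))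
    (hf0 : ∀ s ∈ Set.Icc 0 sbar, 0 ≤ f s) (hlam : 0 ≤ lam) (u : ProductionPolicy sbar ξ x) (n : ℕ) :
    noise.map (fun E => (incrementTimes f lam u E n, E n)) =
      (noise.map fun E => incrementTimes f lam u E n).prod (expMeasure 1) := by
  have hX := measurable_incrementTimes hf hf0 hlam u n
  have hindep : iIndepFun (fun i (E : ℕ → ℝ) => E i) noise :=
    iIndepFun_infinitePi (P := fun _ : ℕ => expMeasure 1) (X := fun _ e => e)
      fun _ => measurable_id
  have h := hindep.indepFun_finset (Finset.range n) {n} (by simp) fun i => measurable_pi_apply i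
  -- Padding with zeros exhibits the first `n` times as a function of the first `n` coordinates of
  -- the noise.
  have hext : Measurable fun (z : Finset.range n → ℝ) (i : ℕ) =>
      if hi : i ∈ Finset.range n then z ⟨i, hi⟩ else 0 := by
    refine measurable_pi_lambda _ fun i => ?_
    by_cases hi : i ∈ Finset.range n
    · simpa only [hi, dif_pos] using measurable_pi_apply _
    · simp only [hi, dif_neg, not_false_eq_true, measurable_const]
  have h' := h.comp (hX.comp hext)
    (measurable_pi_apply (⟨n, Finset.mem_singleton_self n⟩ : ({n} : Finset ℕ)))
  have h'' : IndepFun (fun E => incrementTimes f lam u E n) (fun E : ℕ → ℝ => E n) noise := by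
    have heq : (fun E => incrementTimes f lam u E n) = ((fun E => incrementTimes f lam u E n) ∘
        fun (z : Finset.range n → ℝ) (i : ℕ) => if hi : i ∈ Finset.range n then z ⟨i, hi⟩ else 0) ∘
        fun (E : ℕ → ℝ) i => E i := by
      ext1 E
      refine incrementTimes_congr u n fun i hi => ?_
      simp [hi]
    rw [heq]
    exact h'
  rw [(indepFun_iff_map_prod_eq_prod_map_map hX.aemeasurable
    (measurable_pi_apply n).aemeasurable).1 h'', map_noise_eval]

end Times

/-! ### Expected gain of a stage -/

/-- The gain in value during the stage that starts with the `n`-th increment and ends with the next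
increment or with the time horizon `t`, whichever comes first, if `V y τ` is the value of level `y`
with a time `τ` to go. -/
noncomputable def stageGain (f r : ℝ → ℝ) (c : ℕ → ℝ) (lam : ℝ) (u : ProductionPolicy sbar ξ x)
    (V : ℕ → ℝ → ℝ) (t : ℝ) {n : ℕ} (h : Fin n → ℝ≥0∞) (e : ℝ) : ℝ :=
  if lastTime h ≤ ENNReal.ofReal t then
    (∫ v in (lastTime h).toReal..(min (nextTime f lam u h e) (ENNReal.ofReal t)).toReal,
        r (u.rate n (fun i => (h i).toReal) v))
      + (if nextTime f lam u h e ≤ ENNReal.ofReal t then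
          V (x + n + 1) (t - (min (nextTime f lam u h e) (ENNReal.ofReal t)).toReal)
        else -c (x + n))
      - V (x + n) (t - (lastTime h).toReal)
  else 0

section Gain

variable {f r : ℝ → ℝ} {c : ℕ → ℝ} {lam : ℝ} {V : ℕ → ℝ → ℝ} {t : ℝ}

lemma measurable_stageGain (hf : ContinuousOn f (Set.Icc 0 sbar))
    (hf0 : ∀ s ∈ Set.Icc 0 sbar, 0 ≤ f s) (hlam : 0 ≤ lam) (hr : ContinuousOn r (Set.Icc 0 sbar))
    (hV : ∀ y, Continuous (V y)) (u : ProductionPolicy sbar ξ x) (n : ℕ) :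
    Measurable fun p : (Fin n → ℝ≥0∞) × ℝ => stageGain f r c lam u V t p.1 p.2 := by
  have h1 : Measurable fun p : (Fin n → ℝ≥0∞) × ℝ => lastTime p.1 :=
    (measurable_lastTime n).comp measurable_fst
  have h2 := measurable_nextTime hf hf0 hlam u n
  have h3 : Measurable fun p : (Fin n → ℝ≥0∞) × ℝ =>
      (min (nextTime f lam u p.1 p.2) (ENNReal.ofReal t)).toReal :=
    (h2.min measurable_const).ennreal_toReal
  refine Measurable.ite (measurableSet_le h1 measurable_const)
    (((?_ : Measurable _).add (Measurable.ite (measurableSet_le h2 measurable_const) ?_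
      measurable_const)).sub ?_) measurable_const
  · exact measurable_intervalIntegral (g := fun z : ((Fin n → ℝ≥0∞) × ℝ) × ℝ =>
      r (u.rate n (fun i => (z.1.1 i).toReal) z.2)) h1.ennreal_toReal h3
      ((measurable_comp_rate hr u n).comp
        ((measurable_fst.comp measurable_fst).prodMk measurable_snd))
  · exact (hV _).measurable.comp (measurable_const.sub h3)
  · exact (hV _).measurable.comp (measurable_const.sub h1.ennreal_toReal)

lemma toReal_min_nextTime_mem (ht : 0 ≤ t) (u : ProductionPolicy sbar ξ x) {n : ℕ}
    {h : Fin n → ℝ≥0∞} (hh : lastTime h ≤ ENNReal.ofReal t) (e : ℝ) :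
    (min (nextTime f lam u h e) (ENNReal.ofReal t)).toReal ∈ Set.Icc (lastTime h).toReal t := by
  have hne : min (nextTime f lam u h e) (ENNReal.ofReal t) ≠ ⊤ :=
    ne_top_of_le_ne_top ENNReal.ofReal_ne_top (min_le_right _ _)
  constructor
  · exact ENNReal.toReal_mono hne (le_min (lastTime_le_nextTime u h e) hh)
  · exact ENNReal.toReal_le_of_le_ofReal ht (min_le_right _ _)

lemma exists_abs_stageGain_le (hr : ContinuousOn r (Set.Icc 0 sbar))
    (hV : ∀ y, ∃ C, ∀ t, |V y t| ≤ C) (ht : 0 ≤ t) (u : ProductionPolicy sbar ξ x) (n : ℕ) :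
    ∃ B, ∀ (h : Fin n → ℝ≥0∞) (e : ℝ), |stageGain f r c lam u V t h e| ≤ B := by
  obtain ⟨R, hR0, hR⟩ := exists_abs_comp_rate_le (ξ := ξ) (x := x) hr
  obtain ⟨C₁, hC₁⟩ := hV (x + n + 1)
  obtain ⟨C₀, hC₀⟩ := hV (x + n)
  have hC₁0 : 0 ≤ C₁ := (abs_nonneg _).trans (hC₁ 0)
  have hC₀0 : 0 ≤ C₀ := (abs_nonneg _).trans (hC₀ 0)
  refine ⟨R * t + (C₁ + |c (x + n)|) + C₀, fun h e => ?_⟩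
  unfold stageGain
  by_cases hh : lastTime h ≤ ENNReal.ofReal t
  · rw [if_pos hh]
    have hm := toReal_min_nextTime_mem (f := f) (lam := lam) ht u hh e
    have hint : |∫ v in (lastTime h).toReal..(min (nextTime f lam u h e)
        (ENNReal.ofReal t)).toReal, r (u.rate n (fun i => (h i).toReal) v)| ≤ R * t := by
      rw [← Real.norm_eq_abs]
      refine (intervalIntegral.norm_integral_le_of_norm_le_const fun v _ => hR u n _ v).trans ?_
      rw [abs_of_nonneg (by linarith [hm.1])]
      have : 0 ≤ (lastTime h).toReal := ENNReal.toReal_nonneg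
      exact mul_le_mul_of_nonneg_left (by linarith [hm.2]) hR0
    refine (abs_sub _ _).trans (add_le_add ((abs_add_le _ _).trans (add_le_add hint ?_)) (hC₀ _))
    split_ifs
    · exact (hC₁ _).trans (le_add_of_nonneg_right (abs_nonneg _))
    · rw [abs_neg]
      exact le_add_of_nonneg_left hC₁0
  · rw [if_neg hh, abs_zero]
    positivity

/-- The past and `E n` have a product law, so by Fubini a bound that is uniform over frozen
histories survives averaging over the history. -/
lemma integral_noise_stageGain (hf : ContinuousOn f (Set.Icc 0 sbar))
    (hf0 : ∀ s ∈ Set.Icc 0 sbar, 0 ≤ f s) (hlam : 0 ≤ lam) (hr : ContinuousOn r (Set.Icc 0 sbar))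
    (hV : ∀ y, Continuous (V y)) (hVb : ∀ y, ∃ C, ∀ t, |V y t| ≤ C) (ht : 0 ≤ t)
    (u : ProductionPolicy sbar ξ x) (n : ℕ) {a b : ℝ}
    (hab : ∀ h : Fin n → ℝ≥0∞, ∫ e, stageGain f r c lam u V t h e ∂expMeasure 1 ∈ Set.Icc a b) :
    Integrable (fun E => stageGain f r c lam u V t (incrementTimes f lam u E n) (E n)) noise ∧
    ∫ E, stageGain f r c lam u V t (incrementTimes f lam u E n) (E n) ∂noise ∈ Set.Icc a b := by
  have hX := measurable_incrementTimes hf hf0 hlam u n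
  have hpair : Measurable fun E : ℕ → ℝ => (incrementTimes f lam u E n, E n) :=
    hX.prodMk (measurable_pi_apply n)
  have hmeas := measurable_stageGain (c := c) (t := t) hf hf0 hlam hr hV u n
  obtain ⟨B, hB⟩ := exists_abs_stageGain_le (f := f) (c := c) (lam := lam) hr hVb ht u n
  have : IsProbabilityMeasure (noise.map fun E => incrementTimes f lam u E n) :=
    Measure.isProbabilityMeasure_map hX.aemeasurable
  have hint : Integrable (fun p : (Fin n → ℝ≥0∞) × ℝ => stageGain f r c lam u V t p.1 p.2)
      ((noise.map fun E => incrementTimes f lam u E n).prod (expMeasure 1)) :=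
    Integrable.of_bound (C := B) hmeas.aestronglyMeasurable
      (Filter.Eventually.of_forall fun p => hB p.1 p.2)
  refine ⟨Integrable.of_bound (C := B) (hmeas.comp hpair).aestronglyMeasurable
    (Filter.Eventually.of_forall fun E => hB _ _), ?_⟩
  rw [← integral_map (φ := fun E : ℕ → ℝ => (incrementTimes f lam u E n, E n))
    (f := fun p : (Fin n → ℝ≥0∞) × ℝ => stageGain f r c lam u V t p.1 p.2) hpair.aemeasurable
    hmeas.aestronglyMeasurable, map_noise_incrementTimes hf hf0 hlam u n, integral_prod _ hint]
  have hint' := hint.integral_prod_left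
  constructor
  · simpa using integral_mono (integrable_const a) hint' fun h => (hab h).1
  · simpa using integral_mono hint' (integrable_const b) fun h => (hab h).2

/-- The expected gain of a stage is nonpositive if the value function dominates the rate of gain,
and almost zero if the policy is almost optimal. -/
lemma integral_stageGain_mem_Icc (hf : ContinuousOn f (Set.Icc 0 sbar))
    (hf0 : ∀ s ∈ Set.Icc 0 sbar, 0 ≤ f s) (hlam : 0 ≤ lam) (hr : ContinuousOn r (Set.Icc 0 sbar))
    (hV : ∀ y, Continuous (V y)) (hVb : ∀ y, ∃ C, ∀ t, |V y t| ≤ C) (ht : 0 ≤ t) {T₀ : ℝ}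
    (htT : t ≤ T₀) (u : ProductionPolicy sbar ξ x) {n : ℕ} (hV0 : V (x + n) 0 = -c (x + n))
    {D : ℝ → ℝ} (hDc : Continuous D) (hD : ∀ v ∈ Set.Ioo 0 T₀, HasDerivAt (V (x + n)) (D v) v)
    {δ : ℝ} (hδ : 0 ≤ δ)
    (hgap : ∀ (h : Fin n → ℝ), ∀ v ∈ Set.Ioo 0 t,
      r (u.rate n h v) + lam * f (u.rate n h v) * (V (x + n + 1) (t - v) - V (x + n) (t - v))
        - D (t - v) ∈ Set.Icc (-δ) 0) (h : Fin n → ℝ≥0∞) :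
    ∫ e, stageGain f r c lam u V t h e ∂expMeasure 1 ∈ Set.Icc (-(δ * t)) 0 := by
  by_cases hh : lastTime h ≤ ENNReal.ofReal t
  swap
  · simp only [stageGain, if_neg hh, integral_zero]
    exact ⟨by simpa using mul_nonneg hδ ht, le_rfl⟩
  have hφ : ContinuousOn (fun s => lam * f s) (Set.Icc 0 sbar) := hf.const_mul lam
  obtain ⟨R, hR0, hR⟩ := exists_abs_comp_rate_le (ξ := ξ) (x := x) hr
  obtain ⟨M, hM0, hM⟩ := exists_abs_comp_rate_le (ξ := ξ) (x := x) hφ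
  obtain ⟨C₁, hC₁⟩ := hVb (x + n + 1)
  obtain ⟨C₀, hC₀⟩ := hVb (x + n)
  have hfin : lastTime h ≠ ⊤ := ne_top_of_le_ne_top ENNReal.ofReal_ne_top hh
  have h0T : 0 ≤ (lastTime h).toReal := ENNReal.toReal_nonneg
  have hTt : (lastTime h).toReal ≤ t := ENNReal.toReal_le_of_le_ofReal ht hh
  have hiff : ∀ v ∈ Set.Icc (lastTime h).toReal t, ∀ e,
      nextTime f lam u h e ≤ ENNReal.ofReal v ↔
        e ≤ ∫ w in (lastTime h).toReal..v, lam * f (u.rate n (fun i => (h i).toReal) w) := by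
    intro v hv e
    have h1 := nextTime_le_iff hf hf0 hlam u h e v.toNNReal
    have h2 : lastTime h ≤ (v.toNNReal : ℝ≥0∞) := by
      rw [← ENNReal.ofReal_toReal hfin]
      exact ENNReal.ofReal_le_ofReal hv.1
    rw [Real.coe_toNNReal _ (h0T.trans hv.1)] at h1
    exact h1.trans (and_iff_right h2)
  have hm : Measurable fun e => (min (nextTime f lam u h e) (ENNReal.ofReal t)).toReal :=
    (((measurable_nextTime hf hf0 hlam u n).comp
      (measurable_const.prodMk measurable_id)).min measurable_const).ennreal_toReal
  -- For a frozen history the rate is a deterministic function of time, and `m` is the next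
  -- increment time capped at `t`.
  have key := integral_stage_mem_Icc (T := (lastTime h).toReal) h0T hTt htT
    (ρ := fun v => r (u.rate n (fun i => (h i).toReal) v))
    (q := fun v => lam * f (u.rate n (fun i => (h i).toReal) v))
    (v₀ := V (x + n)) (v₁ := V (x + n + 1)) (D := D)
    (measurable_comp_rate_apply hr u h) (fun v => hR u n _ v)
    (measurable_comp_rate_apply hφ u h) (fun v => mul_nonneg hlam (hf0 _ (u.rate_mem _ _ _)))
    (fun v => (le_abs_self _).trans (hM u n _ v)) (hV _) hC₀ (hV _) hC₁ hDc hD hδ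
    (fun v hv => hgap _ v ⟨h0T.trans_lt hv.1, hv.2⟩) hm
    (fun e => toReal_min_nextTime_mem ht u hh e) ?_ ?_
  · rw [hV0] at key
    simp only [stageGain, if_pos hh, hiff t ⟨hTt, le_rfl⟩]
    exact key
  · intro v hv e he
    have hle : nextTime f lam u h e ≤ ENNReal.ofReal t := (hiff t ⟨hTt, le_rfl⟩ e).2 he
    rw [← hiff v hv e, min_eq_left hle,
      ENNReal.le_ofReal_iff_toReal_le (ne_top_of_le_ne_top ENNReal.ofReal_ne_top hle)
        (h0T.trans hv.1)]
  · intro e he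
    have hlt : ¬ nextTime f lam u h e ≤ ENNReal.ofReal t := fun hle =>
      he.not_ge ((hiff t ⟨hTt, le_rfl⟩ e).1 hle)
    rw [min_eq_right (not_le.1 hlt).le, ENNReal.toReal_ofReal ht]

end Gain

/-! ### Telescoping along a path -/

section Path

variable {f r : ℝ → ℝ} {c : ℕ → ℝ} {lam : ℝ} {V : ℕ → ℝ → ℝ} {t : ℝ}

lemma lastTime_incrementTimes_succ (u : ProductionPolicy sbar ξ x) (E : ℕ → ℝ) (n : ℕ) :
    lastTime (incrementTimes f lam u E (n + 1)) =
      nextTime f lam u (incrementTimes f lam u E n) (E n) :=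
  incrementTimes_succ_last u E n

lemma monotone_lastTime_incrementTimes (u : ProductionPolicy sbar ξ x) (E : ℕ → ℝ) :
    Monotone fun n => lastTime (incrementTimes f lam u E n) :=
  monotone_nat_of_le_succ fun n => by
    rw [lastTime_incrementTimes_succ]
    exact lastTime_le_nextTime u _ _

lemma increments_eq (u : ProductionPolicy sbar ξ x) (E : ℕ → ℝ) {n : ℕ} {τ : ℝ}
    (h1 : lastTime (incrementTimes f lam u E n) ≤ ENNReal.ofReal τ)
    (h2 : ENNReal.ofReal τ < lastTime (incrementTimes f lam u E (n + 1))) :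
    increments f lam u E τ = n := by
  have hset : {k : ℕ | incrementTimes f lam u E (k + 1) (Fin.last k) ≤ ENNReal.ofReal τ} =
      Set.Iio n := by
    ext k
    change lastTime (incrementTimes f lam u E (k + 1)) ≤ ENNReal.ofReal τ ↔ k < n
    constructor
    · intro hk
      by_contra! hnk
      have := monotone_lastTime_incrementTimes (f := f) (lam := lam) u E
        (Nat.succ_le_succ hnk)
      exact absurd (this.trans hk) (not_le.2 h2)
    · intro hk
      exact (monotone_lastTime_incrementTimes (f := f) (lam := lam) u E
        (Nat.succ_le_of_lt hk)).trans h1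
  rw [increments, hset, Set.ncard_eq_toFinset_card']
  simp

lemma productionRate_eq (u : ProductionPolicy sbar ξ x) (E : ℕ → ℝ) {n : ℕ} {τ : ℝ}
    (h1 : lastTime (incrementTimes f lam u E n) ≤ ENNReal.ofReal τ)
    (h2 : ENNReal.ofReal τ < lastTime (incrementTimes f lam u E (n + 1))) :
    productionRate f lam u E τ = u.rate n (fun i => (incrementTimes f lam u E n i).toReal) τ := by
  rw [productionRate, increments_eq u E h1 h2]

/-- Along a path, the value at the start and the gains of the first `n` stages add up to the
revenue up to the `n`-th increment and the value that remains then. -/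
lemma value_add_sum_stageGain (hr : ContinuousOn r (Set.Icc 0 sbar))
    (u : ProductionPolicy sbar ξ x) (E : ℕ → ℝ) (n : ℕ) :
    IntervalIntegrable (fun τ => r (productionRate f lam u E τ)) volume 0
      (min (lastTime (incrementTimes f lam u E n)) (ENNReal.ofReal t)).toReal ∧
    V x t + ∑ k ∈ Finset.range n, stageGain f r c lam u V t (incrementTimes f lam u E k) (E k) =
      (∫ τ in (0 : ℝ)..(min (lastTime (incrementTimes f lam u E n)) (ENNReal.ofReal t)).toReal,
        r (productionRate f lam u E τ)) +
      if lastTime (incrementTimes f lam u E n) ≤ ENNReal.ofReal t then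
        V (x + n) (t - (lastTime (incrementTimes f lam u E n)).toReal)
      else -c (x + increments f lam u E t) := by
  induction n with
  | zero => simp [lastTime]
  | succ n ih =>
    obtain ⟨hi, heq⟩ := ih
    rw [Finset.sum_range_succ, ← add_assoc, heq]
    have hmono : lastTime (incrementTimes f lam u E n) ≤
        lastTime (incrementTimes f lam u E (n + 1)) :=
      monotone_lastTime_incrementTimes u E n.le_succ
    by_cases hle : lastTime (incrementTimes f lam u E n) ≤ ENNReal.ofReal t
    swap
    · have hle' : ¬ lastTime (incrementTimes f lam u E (n + 1)) ≤ ENNReal.ofReal t :=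
        fun h => hle (hmono.trans h)
      rw [min_eq_right (not_le.1 hle).le] at hi ⊢
      rw [min_eq_right (not_le.1 hle').le, stageGain, if_neg hle, if_neg hle, if_neg hle', add_zero]
      exact ⟨hi, rfl⟩
    have hfin : lastTime (incrementTimes f lam u E n) ≠ ⊤ :=
      ne_top_of_le_ne_top ENNReal.ofReal_ne_top hle
    rw [min_eq_left hle] at hi ⊢
    have hne : min (lastTime (incrementTimes f lam u E (n + 1))) (ENNReal.ofReal t) ≠ ⊤ :=
      ne_top_of_le_ne_top ENNReal.ofReal_ne_top (min_le_right _ _)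
    have hab : (lastTime (incrementTimes f lam u E n)).toReal ≤
        (min (lastTime (incrementTimes f lam u E (n + 1))) (ENNReal.ofReal t)).toReal :=
      ENNReal.toReal_mono hne (le_min hmono hle)
    -- Strictly between the two increments the count is `n`; the endpoints, where it may differ,
    -- form a null set.
    have hrate : Set.EqOn (fun τ => r (productionRate f lam u E τ))
        (fun τ => r (u.rate n (fun i => (incrementTimes f lam u E n i).toReal) τ))
        (Set.Ioo (lastTime (incrementTimes f lam u E n)).toReal
          (min (lastTime (incrementTimes f lam u E (n + 1))) (ENNReal.ofReal t)).toReal) := by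
      intro v hv
      have hv0 : 0 ≤ v := ENNReal.toReal_nonneg.trans hv.1.le
      simp only
      rw [productionRate_eq u E (n := n)]
      · exact (ENNReal.le_ofReal_iff_toReal_le hfin hv0).2 hv.1.le
      · exact ((ENNReal.ofReal_lt_iff_lt_toReal hv0 hne).2 hv.2).trans_le (min_le_left _ _)
    have hi' : IntervalIntegrable (fun τ => r (productionRate f lam u E τ)) volume
        (lastTime (incrementTimes f lam u E n)).toReal
        (min (lastTime (incrementTimes f lam u E (n + 1))) (ENNReal.ofReal t)).toReal := by
      have h := intervalIntegrable_comp_rate hr u (incrementTimes f lam u E n)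
        (lastTime (incrementTimes f lam u E n)).toReal
        (min (lastTime (incrementTimes f lam u E (n + 1))) (ENNReal.ofReal t)).toReal
      rw [intervalIntegrable_iff_integrableOn_Ioo_of_le hab] at h ⊢
      exact h.congr_fun hrate.symm measurableSet_Ioo
    have hint : ∫ τ in (lastTime (incrementTimes f lam u E n)).toReal..
          (min (lastTime (incrementTimes f lam u E (n + 1))) (ENNReal.ofReal t)).toReal,
          r (productionRate f lam u E τ) =
        ∫ τ in (lastTime (incrementTimes f lam u E n)).toReal..
          (min (lastTime (incrementTimes f lam u E (n + 1))) (ENNReal.ofReal t)).toReal,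
          r (u.rate n (fun i => (incrementTimes f lam u E n i).toReal) τ) := by
      rw [intervalIntegral.integral_of_le hab, intervalIntegral.integral_of_le hab,
        integral_Ioc_eq_integral_Ioo, integral_Ioc_eq_integral_Ioo]
      exact setIntegral_congr_fun measurableSet_Ioo hrate
    refine ⟨hi.trans hi', ?_⟩
    rw [← intervalIntegral.integral_add_adjacent_intervals hi hi', hint, stageGain, if_pos hle,
      if_pos hle, ← lastTime_incrementTimes_succ]
    by_cases hle' : lastTime (incrementTimes f lam u E (n + 1)) ≤ ENNReal.ofReal t
    · rw [if_pos hle', if_pos hle', min_eq_left hle', add_assoc x n 1]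
      ring
    · rw [if_neg hle', if_neg hle', increments_eq u E hle (not_le.1 hle')]
      ring

/-- Once the system is off, the integrated intensity stays 0 and never reaches a positive level; for
`e ≤ 0` the passage would be immediate. -/
lemma nextTime_eq_top (hf0 : f 0 = 0) (u : ProductionPolicy sbar ξ x) {n : ℕ} (hn : ξ ≤ x + n)
    (h : Fin n → ℝ≥0∞) {e : ℝ} (he : 0 < e) : nextTime f lam u h e = ⊤ := by
  simp only [nextTime, u.rate_eq_zero n _ _ hn, hf0, mul_zero, intervalIntegral.integral_zero,
    not_le.2 he, and_false, iInf_false, iInf_top]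

/-- The increment after stage `n` never comes, so the telescoping sum ends in its terminal branch
and no value of `V` is left over. -/
lemma profit_eq (hf0 : f 0 = 0) (hr : ContinuousOn r (Set.Icc 0 sbar)) (ht : 0 ≤ t)
    (u : ProductionPolicy sbar ξ x) {E : ℕ → ℝ} {n : ℕ} (hn : ξ ≤ x + n) (he : 0 < E n) :
    profit f r c lam u t E = V x t + ∑ k ∈ Finset.range (n + 1),
      stageGain f r c lam u V t (incrementTimes f lam u E k) (E k) := by
  have htop : lastTime (incrementTimes f lam u E (n + 1)) = ⊤ := by
    rw [lastTime_incrementTimes_succ, nextTime_eq_top hf0 u hn _ he]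
  rw [(value_add_sum_stageGain hr u E (n + 1)).2, htop, min_eq_right le_top,
    ENNReal.toReal_ofReal ht, if_neg (not_le.2 ENNReal.ofReal_lt_top)]
  rfl

lemma ae_noise_pos (n : ℕ) : ∀ᵐ E ∂noise, 0 < E n := by
  have h := ae_expMeasure_one_pos
  rw [← map_noise_eval n] at h
  exact ae_of_ae_map (measurable_pi_apply n).aemeasurable h

end Path

/-! ### Verification: bounds and nearly optimal policies -/

section Verification

variable {f r : ℝ → ℝ} {c : ℕ → ℝ} {lam : ℝ} {V : ℕ → ℝ → ℝ} {t T : ℝ}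

/-- A policy whose instantaneous gain falls short of the Hamiltonian by at most `δ` attains the
value function up to a multiple of `δ`; no policy exceeds it. -/
lemma expectedProfit_mem_Icc (hf : ContinuousOn f (Set.Icc 0 sbar))
    (hf0 : ∀ s ∈ Set.Icc 0 sbar, 0 ≤ f s) (hfz : f 0 = 0) (hlam : 0 ≤ lam)
    (hr : ContinuousOn r (Set.Icc 0 sbar))
    (hH : Continuous (hamiltonian (Set.Icc 0 sbar) (fun s => lam * f s) r))
    (hV : IsValueFunction (Set.Icc 0 sbar) (fun s => lam * f s) r c ξ T V) (hx : x ≤ ξ)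
    (ht : t ∈ Set.Icc 0 T) (u : ProductionPolicy sbar ξ x) {δ : ℝ} (hδ : 0 ≤ δ)
    (hgap : ∀ n, x + n < ξ → ∀ (h : Fin n → ℝ), ∀ v ∈ Set.Ioo 0 t,
      hamiltonian (Set.Icc 0 sbar) (fun s => lam * f s) r
          (V (x + n) (t - v) - V (x + n + 1) (t - v)) - δ ≤
        r (u.rate n h v) - lam * f (u.rate n h v) *
          (V (x + n) (t - v) - V (x + n + 1) (t - v))) :
    u.expectedProfit f r c lam t ∈ Set.Icc (V x t - (ξ - x + 1 : ℕ) * (δ * t)) (V x t) := by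
  have hstage : ∀ n ∈ Finset.range (ξ - x + 1), ∀ h : Fin n → ℝ≥0∞,
      ∫ e, stageGain f r c lam u V t h e ∂expMeasure 1 ∈ Set.Icc (-(δ * t)) 0 := by
    intro n hn h
    have hn : x + n ≤ ξ := by
      have := Finset.mem_range.1 hn
      omega
    rcases hn.lt_or_eq with hlt | heq
    · have hc0 := hV.continuous (x + n)
      have hc1 := hV.continuous (x + n + 1)
      refine integral_stageGain_mem_Icc hf hf0 hlam hr hV.continuous hV.bounded ht.1 ht.2 u
        (hV.zero _ hn) (hH.comp (hc0.sub hc1)) (hV.hasDerivAt _ hlt) hδ ?_ h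
      intro h v hv
      have h1 := hgap n hlt h v hv
      have h2 := le_hamiltonian (φ := fun s => lam * f s) isCompact_Icc (hf.const_mul lam) hr
        (u.rate_mem n h v) (V (x + n) (t - v) - V (x + n + 1) (t - v))
      simp only [Function.comp_apply, Pi.sub_apply]
      constructor <;> linarith
    -- At level `ξ` the rate is 0, so the gap vanishes and the value at level `ξ + 1` has weight 0.
    · refine integral_stageGain_mem_Icc (D := fun _ => r 0) hf hf0 hlam hr hV.continuous hV.bounded
        ht.1 ht.2 u (hV.zero _ hn) continuous_const (heq ▸ hV.top) hδ ?_ h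
      intro h v hv
      rw [u.rate_eq_zero n h v heq.ge, hfz]
      simpa using hδ
  have hint := fun n hn => integral_noise_stageGain hf hf0 hlam hr hV.continuous hV.bounded ht.1 u n
    (hstage n hn)
  have heq : u.expectedProfit f r c lam t = V x t + ∑ n ∈ Finset.range (ξ - x + 1),
      ∫ E, stageGain f r c lam u V t (incrementTimes f lam u E n) (E n) ∂noise := by
    rw [← integral_finsetSum _ fun n hn => (hint n hn).1]
    have hconst : V x t = ∫ _, V x t ∂noise := by simp
    conv_rhs => rw [hconst]
    rw [← integral_add (integrable_const _) (integrable_finsetSum _ fun n hn => (hint n hn).1)]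
    refine integral_congr_ae ?_
    filter_upwards [ae_noise_pos (ξ - x)] with E hE
    exact profit_eq hfz hr ht.1 u (by omega) hE
  rw [heq]
  constructor
  · have := Finset.card_nsmul_le_sum _ _ _ fun n hn => (hint n hn).2.1
    rw [Finset.card_range, nsmul_eq_mul] at this
    linarith
  · have := Finset.sum_nonpos fun n hn => (hint n hn).2.2
    linarith

/-- The upper bound in `expectedProfit_mem_Icc` does not involve `δ`, so any finite `δ` will do;
compactness bounds the shortfall of every policy, and the sum over levels makes the bound uniform.
-/
lemma expectedProfit_le (hf : ContinuousOn f (Set.Icc 0 sbar))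
    (hf0 : ∀ s ∈ Set.Icc 0 sbar, 0 ≤ f s) (hfz : f 0 = 0) (hlam : 0 ≤ lam)
    (hr : ContinuousOn r (Set.Icc 0 sbar))
    (hH : Continuous (hamiltonian (Set.Icc 0 sbar) (fun s => lam * f s) r))
    (hV : IsValueFunction (Set.Icc 0 sbar) (fun s => lam * f s) r c ξ T V) (hx : x ≤ ξ)
    (ht : t ∈ Set.Icc 0 T) (u : ProductionPolicy sbar ξ x) :
    u.expectedProfit f r c lam t ≤ V x t := by
  have hb : ∀ y, ∃ B, 0 ≤ B ∧ ∀ s ∈ Set.Icc 0 sbar, ∀ v ∈ Set.Icc 0 t,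
      hamiltonian (Set.Icc 0 sbar) (fun s => lam * f s) r (V y (t - v) - V (y + 1) (t - v)) -
        (r s - lam * f s * (V y (t - v) - V (y + 1) (t - v))) ≤ B := by
    intro y
    have hc0 := hV.continuous y
    have hc1 := hV.continuous (y + 1)
    have hd : Continuous fun p : ℝ × ℝ => V y (t - p.2) - V (y + 1) (t - p.2) := by fun_prop
    have hfst : Set.MapsTo Prod.fst (Set.Icc 0 sbar ×ˢ Set.Icc 0 t) (Set.Icc (0 : ℝ) sbar) :=
      fun p hp => hp.1
    have hcont : ContinuousOn (fun p : ℝ × ℝ =>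
        hamiltonian (Set.Icc 0 sbar) (fun s => lam * f s) r
          (V y (t - p.2) - V (y + 1) (t - p.2)) -
        (r p.1 - lam * f p.1 * (V y (t - p.2) - V (y + 1) (t - p.2))))
        (Set.Icc 0 sbar ×ˢ Set.Icc 0 t) :=
      (hH.comp hd).continuousOn.sub ((hr.comp continuousOn_fst hfst).sub
        (((hf.comp continuousOn_fst hfst).const_mul lam).mul hd.continuousOn))
    obtain ⟨B, hB⟩ := (isCompact_Icc.prod isCompact_Icc).exists_bound_of_continuousOn hcont
    exact ⟨max B 0, le_max_right _ _, fun s hs v hv =>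
      (le_abs_self _).trans ((hB (s, v) ⟨hs, hv⟩).trans (le_max_left _ _))⟩
  choose B hB0 hB using hb
  refine (expectedProfit_mem_Icc hf hf0 hfz hlam hr hH hV hx ht u
    (δ := ∑ n ∈ Finset.range (ξ - x), B (x + n)) (Finset.sum_nonneg fun n _ => hB0 _) ?_).2
  intro n hn h v hv
  have h1 := hB (x + n) _ (u.rate_mem n h v) v ⟨hv.1.le, hv.2.le⟩
  have h2 : B (x + n) ≤ ∑ n ∈ Finset.range (ξ - x), B (x + n) :=
    Finset.single_le_sum (f := fun n => B (x + n)) (fun n _ => hB0 _)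
      (Finset.mem_range.2 (by omega))
  linarith

/-- Nearly optimal policies, obtained by rounding the loss of value at an increment to a grid. -/
lemma exists_le_expectedProfit (hsbar : 0 ≤ sbar) (hf : ContinuousOn f (Set.Icc 0 sbar))
    (hf0 : ∀ s ∈ Set.Icc 0 sbar, 0 ≤ f s) (hfz : f 0 = 0) (hlam : 0 ≤ lam)
    (hr : ContinuousOn r (Set.Icc 0 sbar))
    (hH : Continuous (hamiltonian (Set.Icc 0 sbar) (fun s => lam * f s) r))
    (hV : IsValueFunction (Set.Icc 0 sbar) (fun s => lam * f s) r c ξ T V) (hx : x ≤ ξ)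
    (ht : t ∈ Set.Icc 0 T) {ε : ℝ} (hε : 0 < ε) :
    ∃ u : ProductionPolicy sbar ξ x, V x t - ε ≤ u.expectedProfit f r c lam t := by
  have hφ : ContinuousOn (fun s => lam * f s) (Set.Icc 0 sbar) := hf.const_mul lam
  have hne : (Set.Icc 0 sbar).Nonempty := ⟨0, le_rfl, hsbar⟩
  have hanti := antitone_hamiltonian isCompact_Icc hne hφ hr fun s hs => mul_nonneg hlam (hf0 s hs)
  obtain ⟨M, hM⟩ := isCompact_Icc.bddAbove_image hφ
  have hM : ∀ s ∈ Set.Icc 0 sbar, lam * f s ≤ M := fun s hs => hM ⟨s, hs, rfl⟩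
  have hM0 : 0 ≤ M := (mul_nonneg hlam (hf0 0 ⟨le_rfl, hsbar⟩)).trans (hM 0 ⟨le_rfl, hsbar⟩)
  set B : ℝ := (ξ - x + 1 : ℕ) * (M * t) with hBdef
  have hB0 : 0 ≤ B := by
    have := ht.1
    positivity
  -- With `δ = M * η` the total loss over all stages is `η * B ≤ ε`; the `+ 1` guards against `B =
  -- 0`.
  set η : ℝ := ε / (B + 1) with hη
  have hη0 : 0 < η := by positivity
  have hηB : η * B ≤ ε := by
    rw [hη, div_mul_eq_mul_div, div_le_iff₀ (by positivity)]
    nlinarith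
  -- Maximizers are chosen only at the grid points `η * k`; any function on `ℤ` is measurable, so no
  -- measurable selection is needed.
  choose σ hσmem hσ using fun k : ℤ =>
    exists_hamiltonian_eq (φ := fun s => lam * f s) isCompact_Icc hne hφ hr (η * k)
  let d : ℕ → ℝ → ℝ := fun n v => V (x + n) (t - v) - V (x + n + 1) (t - v)
  have hd : ∀ n, Measurable (d n) := fun n => by
    have hc0 := hV.continuous (x + n)
    have hc1 := hV.continuous (x + n + 1)
    exact Continuous.measurable (by fun_prop)
  let u : ProductionPolicy sbar ξ x :=
    { rate := fun n _ v => if ξ ≤ x + n then 0 else σ ⌊d n v / η⌋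
      measurable_rate := fun n => by
        by_cases hn : ξ ≤ x + n
        · simp only [if_pos hn, measurable_const]
        · simp only [if_neg hn]
          exact (measurable_from_top (f := σ)).comp
            (Int.measurable_floor.comp (((hd n).comp measurable_snd).div_const η))
      rate_mem := fun n _ v => by
        split_ifs
        · exact ⟨le_rfl, hsbar⟩
        · exact hσmem _
      rate_eq_zero := fun n _ v hn => if_pos hn }
  refine ⟨u, le_trans ?_ (expectedProfit_mem_Icc hf hf0 hfz hlam hr hH hV hx ht u (δ := M * η)
    (by positivity) ?_).1⟩
  · have : (ξ - x + 1 : ℕ) * (M * η * t) = η * B := by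
      rw [hBdef]
      ring
    linarith
  · intro n hn h v _
    have hrate : u.rate n h v = σ ⌊d n v / η⌋ := if_neg (not_le.2 hn)
    rw [hrate]
    change hamiltonian (Set.Icc 0 sbar) (fun s => lam * f s) r (d n v) - M * η ≤
      r (σ ⌊d n v / η⌋) - lam * f (σ ⌊d n v / η⌋) * d n v
    have h1 : η * ⌊d n v / η⌋ ≤ d n v := by
      have := Int.floor_le (d n v / η)
      rwa [le_div_iff₀ hη0, mul_comm] at this
    have h2 : d n v ≤ η * ⌊d n v / η⌋ + η := by
      have := (Int.lt_floor_add_one (d n v / η)).le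
      rw [div_le_iff₀ hη0] at this
      linarith
    -- Rounding down can only raise `H`, and using the grid maximizer at the true loss costs at most
    -- `M * η`.
    have h3 := hanti h1
    have h4 := hσ ⌊d n v / η⌋
    have h5 : lam * f (σ ⌊d n v / η⌋) * (d n v - η * ⌊d n v / η⌋) ≤ M * η :=
      mul_le_mul (hM _ (hσmem _)) (by linarith) (by linarith) hM0
    linarith

end Verification

end ProductionPolicy

/-! ### Concavity of the optimal profit -/

open ProductionPolicy in
lemma optimalProfit_eq {sbar : ℝ} (hsbar : 0 ≤ sbar) {ξ x : ℕ} {f r : ℝ → ℝ} {c : ℕ → ℝ} {lam : ℝ}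
    {V : ℕ → ℝ → ℝ} {t T : ℝ} (hf : ContinuousOn f (Set.Icc 0 sbar))
    (hf0 : ∀ s ∈ Set.Icc 0 sbar, 0 ≤ f s) (hfz : f 0 = 0) (hlam : 0 ≤ lam)
    (hr : ContinuousOn r (Set.Icc 0 sbar))
    (hH : Continuous (hamiltonian (Set.Icc 0 sbar) (fun s => lam * f s) r))
    (hV : IsValueFunction (Set.Icc 0 sbar) (fun s => lam * f s) r c ξ T V) (hx : x ≤ ξ)
    (ht : t ∈ Set.Icc 0 T) : optimalProfit sbar ξ f r c lam x t = V x t := by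
  have hle := expectedProfit_le hf hf0 hfz hlam hr hH hV hx ht
  have hex := fun {ε : ℝ} (hε : 0 < ε) =>
    exists_le_expectedProfit hsbar hf hf0 hfz hlam hr hH hV hx ht hε
  -- A real supremum is meaningful only over a nonempty bounded family; both properties come from
  -- the verification bounds.
  have : Nonempty (ProductionPolicy sbar ξ x) := ⟨(hex one_pos).choose⟩
  refine le_antisymm (ciSup_le hle) (le_of_forall_pos_le_add fun ε hε => ?_)
  obtain ⟨u, hu⟩ := hex hε
  have hbdd : BddAbove (Set.range fun u : ProductionPolicy sbar ξ x =>
      u.expectedProfit f r c lam t) := ⟨V x t, Set.forall_mem_range.2 hle⟩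
  have := le_ciSup hbdd u
  simp only [optimalProfit]
  linarith

theorem proposition3 (sbar : ℝ) (hsbar : 0 < sbar) (ξ : ℕ) (f r : ℝ → ℝ) (c : ℕ → ℝ)
    (hf_cont : ContinuousOn f (Set.Icc 0 sbar)) (hf_mono : MonotoneOn f (Set.Icc 0 sbar))
    (hf_zero : f 0 = 0)
    (hr_cont : ContinuousOn r (Set.Icc 0 sbar)) (hr_mono : MonotoneOn r (Set.Icc 0 sbar) ∨ AntitoneOn r (Set.Icc 0 sbar))
    (hr_zero : r 0 ≤ 0)
    (hc_nonneg : ∀ y ≤ ξ, 0 ≤ c y) (hc_mono : MonotoneOn c (Set.Iic ξ))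
    (hc_convex : ∀ y, y + 2 ≤ ξ → c (y + 1) - c y ≤ c (y + 2) - c (y + 1))
    (x : ℕ) (hx : x ≤ ξ) (lam : ℝ) (hlam : 0 ≤ lam) :
    ConcaveOn ℝ (Set.Ici 0) fun t : ℝ => optimalProfit sbar ξ f r c lam x t := by
  have h0 : (0 : ℝ) ∈ Set.Icc 0 sbar := ⟨le_rfl, hsbar.le⟩
  have hf0 : ∀ s ∈ Set.Icc 0 sbar, 0 ≤ f s := fun s hs => hf_zero ▸ hf_mono h0 hs hs.1
  have hφ : ContinuousOn (fun s => lam * f s) (Set.Icc 0 sbar) := hf_cont.const_mul lam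
  have hφ0 : ∀ s ∈ Set.Icc 0 sbar, 0 ≤ lam * f s := fun s hs => mul_nonneg hlam (hf0 s hs)
  have hanti := antitone_hamiltonian isCompact_Icc ⟨0, h0⟩ hφ hr_cont hφ0
  have hlow : ∀ d, r 0 ≤ hamiltonian (Set.Icc 0 sbar) (fun s => lam * f s) r d := fun d => by
    simpa [hf_zero] using le_hamiltonian isCompact_Icc hφ hr_cont h0 d
  have hH : Continuous (hamiltonian (Set.Icc 0 sbar) (fun s => lam * f s) r) := by
    obtain ⟨M, hM⟩ := isCompact_Icc.bddAbove_image hφ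
    refine (LipschitzWith.of_dist_le' (K := M) fun d d' => ?_).continuous
    exact abs_hamiltonian_sub_le isCompact_Icc ⟨0, h0⟩ hφ hr_cont hφ0
      (fun s hs => hM ⟨s, hs, rfl⟩) d d'
  refine ⟨convex_Ici 0, fun a ha b hb α β hα hβ hαβ => ?_⟩
  -- Concavity involves only `a`, `b` and a point between them, so a solution up to the horizon `max
  -- a b` suffices.
  have ha' : a ∈ Set.Icc 0 (max a b) := ⟨ha, le_max_left a b⟩
  have hb' : b ∈ Set.Icc 0 (max a b) := ⟨hb, le_max_right a b⟩
  obtain ⟨V, hV⟩ := exists_isValueFunction (T := max a b) isCompact_Icc h0 hφ hr_cont hφ0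
    (by simp [hf_zero]) hc_mono (ha'.1.trans ha'.2)
  have hopt : ∀ t ∈ Set.Icc 0 (max a b), optimalProfit sbar ξ f r c lam x t = V x t := fun t ht =>
    optimalProfit_eq hsbar.le hf_cont hf0 hf_zero hlam hr_cont hH hV hx ht
  simp only
  rw [hopt a ha', hopt b hb', hopt _ (convex_Icc 0 _ ha' hb' hα hβ hαβ)]
  exact (hV.concaveOn hanti hlow hc_convex hx).2 ha' hb' hα hβ hαβ
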